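/- Let $T>0$, $\Omega=(-1,1)$, $V=[-10,10]$, let $h$ be continuous on $[-1,1]$, and let $D=V$ or $D=\mathbb{R}$. Consider the Vlasov--Poisson--Fokker--Planck system with velocities in $D$ and specular reflection: $$\partial_t f+v\,\partial_x f+E\,\partial_v f=\partial_{v}^2 f+\partial_v(vf)\quad\text{on }(0,T)\times\Omega\times \mathrm{int}\,D,\qquad f(0,x,v)=f_0(x,v)\quad (x\in\Omega,\ v\in D),$$ $$\partial_xE(t,x)=\int_{D}f(t,x,v)\,dv-h(x)\quad (t\in[0,T],\ x\in\Omega),\qquad E(t,\pm1)=0,$$ $$f(t,x,v)=f(t,x,-v)\quad\text{for }t\in[0,T],\ x\in\{-1,1\},\ v\in D,\ xv<0 .$$ Let $(f,E)$ be a classical solution: the derivatives in the equations exist, $f(t,x,\cdot)$ is integrable on $D$ for $(t,x)\in[0,T]\times[-1,1]$ with $(t,x)\mapsto\int_D f\,dv$ continuous there, and $E(t,\cdot)$ is continuous on $[-1,1]$ for each $t\in[0,T]$. Suppose that $f\in\widehat C^{(1,1,2)}([0,T]\times[-1,1]\times V)$, i.e. on some open neighbourhood of this compact set all partial derivatives $D^kf$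 with $k\le(1,1,2)$ componentwise exist and are continuous. Let $\bar\sigma\in C^2(\mathbb{R})$ be not a polynomial. For functions $g(t,x,v)$ and $F(t,x)$ define $$Loss^{fp}_{Total}(g,F)=\int_0^T\!\!\int_\Omega\int_V\big|\partial_tg+v\partial_xg+F\partial_vg-\partial_v^2g-\partial_v(vg)\big|^2dv\,dx\,dt+\int_0^T\!\!\int_\Omega\Big|\partial_xF-\Big(\int_Vg\,dv-h\Big)\Big|^2dx\,dt$$ $$+\int_\Omega\int_V|g(0,x,v)-f_0(x,v)|^2dv\,dx+\int_\Omega\Big|F(0,x)-\Big(\int_{-1}^x\!\int_{D}f_0(y,v)\,dv\,dy-\int_{-1}^xh(y)\,dy\Big)\Big|^2dx$$ $$+\int_0^T\sum_{x=\pm1}\int_{\{v\in V:\,xv<0\}}|g(t,x,v)-g(t,x,-v)|^2dv\,dt+\int_0^T\sum_{x=\pm1}|F(t,x)|^2dt .$$ Then there are sequences of one-hidden-layer networks $$f_j(t,x,v)=\sum_{i=1}^{m_j}c_{j,i}\,\bar\sigma\big(\langle w_{j,i},(t,x,v)\rangle+b_{j,i}\big),\qquad E_j(t,x)=\sum_{i=1}^{m_j'}c_{j,i}'\,\bar\sigma\big(\langle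 w_{j,i}',(t,x)\rangle+b_{j,i}'\big)$$ with real parameters such that, as $j\to\infty$: (1) if $D=V$ (velocities truncated to $V$), then $Loss^{fp}_{Total}(f_j,E_j)\to0$; (2) if $D=\mathbb{R}$, then $Loss^{fp}_{Total}(f_j,E_j)\to\int_0^T\int_\Omega\big|\int_{|v|>10}f(t,x,v)\,dv\big|^2dx\,dt$; in particular $Loss^{fp}_{Total}(f_j,E_j)\to0$ if $\int_{|v|>10}f(t,x,v)\,dv=0$ for almost every $(t,x)$. -/

import Mathlib

open MeasureTheory Set Filter Topology
open scoped ENNReal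

noncomputable section

namespace VPFP

/-- `f ∈ C^m(Ω)` for a multi-index `m` and an open set `Ω ⊆ ℝⁿ`: the partial derivatives `D^k f`
exist and are continuous on `Ω` for every multi-index `k ≤ m`.  Here `D k` is the derivative
`D^k f`, and `D^{k + e_i} f` is the derivative of `D^k f` in the `i`-th variable. -/
def ContDiffMultiOn {n : ℕ} (m : Fin n → ℕ) (f : (Fin n → ℝ) → ℝ) (Ω : Set (Fin n → ℝ)) : Prop :=
  ∃ D : (Fin n → ℕ) → (Fin n → ℝ) → ℝ,
    (∀ p ∈ Ω, D 0 p = f p) ∧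
    (∀ k ≤ m, ContinuousOn (D k) Ω) ∧
    ∀ (k : Fin n → ℕ) (i : Fin n), k + Pi.single i 1 ≤ m → ∀ p ∈ Ω,
      HasDerivAt (fun s : ℝ => D k (Function.update p i s)) (D (k + Pi.single i 1) p) (p i)

/-- `f ∈ Ĉ^m(K)`: `f` is of class `C^m` on some open set that contains `K`. -/
def CHat {n : ℕ} (m : Fin n → ℕ) (K : Set (Fin n → ℝ)) (f : (Fin n → ℝ) → ℝ) : Prop :=
  ∃ Ω : Set (Fin n → ℝ), IsOpen Ω ∧ K ⊆ Ω ∧ ContDiffMultiOn m f Ω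

/-- The truncated velocity domain `V = [-10, 10]`. -/
def V : Set ℝ := Icc (-10) 10

/-- The compact set `[0,T] × [-1,1] × V` of points `(t, x, v)`. -/
def phaseCylinder (T : ℝ) : Set (Fin 3 → ℝ) :=
  {p | p 0 ∈ Icc 0 T ∧ p 1 ∈ Icc (-1) 1 ∧ p 2 ∈ V}

/-- A network with one hidden layer and `n` inputs: number of hidden neurons, inner weights and
biases, outer weights. -/
structure ShallowNet (n : ℕ) where
  width : ℕ
  w : Fin width → Fin n → ℝ
  b : Fin width → ℝ
  c : Fin width → ℝ

/-- The output `∑ i, c i * σ (⟨w i, z⟩ + b i)` of a network with activation `σ`. -/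
def ShallowNet.eval {n : ℕ} (N : ShallowNet n) (σ : ℝ → ℝ) (z : Fin n → ℝ) : ℝ :=
  ∑ i, N.c i * σ ((∑ k, N.w i k * z k) + N.b i)

/-- The residual `∂ₜf + v ∂ₓf + E ∂ᵥf - (∂ᵥᵥf + ∂ᵥ(v f))` of the kinetic equation. -/
def kineticResidual (f : ℝ → ℝ → ℝ → ℝ) (E : ℝ → ℝ → ℝ) (t x v : ℝ) : ℝ :=
  deriv (fun s => f s x v) t + v * deriv (fun y => f t y v) x + E t x * deriv (f t x) v
    - (deriv (deriv (f t x)) v + deriv (fun u => u * f t x u) v)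

/-- `(f, E)` is a classical solution, with continuous density, of the Vlasov-Poisson-Fokker-Planck
system (Knudsen number `1`) on the interval `(-1,1)` with velocities in `D`, background charge `h`,
initial datum `f₀`, specular reflection for `f` and the Dirichlet condition for `E`.
`D = univ` is the system on the whole velocity line, `D = V` the system with velocities truncated
to `V`. The outward unit normal at `x = ±1` is `x` itself, so the incoming part of the phase
boundary is `{x * v < 0}`, and the reflected velocity `v - 2 * x * (x * v)` is `-v`. -/
structure IsSolution (D : Set ℝ) (T : ℝ) (h : ℝ → ℝ) (f₀ : ℝ → ℝ → ℝ)
    (f : ℝ → ℝ → ℝ → ℝ) (E : ℝ → ℝ → ℝ) : Prop where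
  differentiable_t : ∀ t ∈ Ioo 0 T, ∀ x ∈ Ioo (-1) 1, ∀ v ∈ interior D,
    DifferentiableAt ℝ (fun s => f s x v) t
  differentiable_x : ∀ t ∈ Ioo 0 T, ∀ x ∈ Ioo (-1) 1, ∀ v ∈ interior D,
    DifferentiableAt ℝ (fun y => f t y v) x
  differentiable_v : ∀ t ∈ Ioo 0 T, ∀ x ∈ Ioo (-1) 1, ∀ v ∈ interior D,
    DifferentiableAt ℝ (f t x) v
  differentiable_vv : ∀ t ∈ Ioo 0 T, ∀ x ∈ Ioo (-1) 1, ∀ v ∈ interior D,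
    DifferentiableAt ℝ (deriv (f t x)) v
  kinetic : ∀ t ∈ Ioo 0 T, ∀ x ∈ Ioo (-1) 1, ∀ v ∈ interior D, kineticResidual f E t x v = 0
  initial : ∀ x ∈ Ioo (-1) 1, ∀ v ∈ D, f 0 x v = f₀ x v
  specular : ∀ t ∈ Icc 0 T, ∀ x ∈ ({-1, 1} : Set ℝ), ∀ v ∈ D, x * v < 0 → f t x v = f t x (-v)
  integrable : ∀ t ∈ Icc 0 T, ∀ x ∈ Icc (-1) 1, IntegrableOn (f t x) D
  continuous_density :
    ContinuousOn (fun p : ℝ × ℝ => ∫ v in D, f p.1 p.2 v) (Icc 0 T ×ˢ Icc (-1) 1)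
  continuous_field : ∀ t ∈ Icc 0 T, ContinuousOn (E t) (Icc (-1) 1)
  poisson : ∀ t ∈ Icc 0 T, ∀ x ∈ Ioo (-1) 1, HasDerivAt (E t) ((∫ v in D, f t x v) - h x) x
  dirichlet : ∀ t ∈ Icc 0 T, ∀ x ∈ ({-1, 1} : Set ℝ), E t x = 0

/-! The loss functions, as extended nonnegative reals (so that a non-integrable square counts
as `∞`). -/

def lossGE1 (T : ℝ) (f : ℝ → ℝ → ℝ → ℝ) (E : ℝ → ℝ → ℝ) : ℝ≥0∞ :=
  ∫⁻ t in Ioo 0 T, ∫⁻ x in Ioo (-1) 1, ∫⁻ v in V, ‖kineticResidual f E t x v‖ₑ ^ 2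

def lossGE2 (T : ℝ) (h : ℝ → ℝ) (f : ℝ → ℝ → ℝ → ℝ) (E : ℝ → ℝ → ℝ) : ℝ≥0∞ :=
  ∫⁻ t in Ioo 0 T, ∫⁻ x in Ioo (-1) 1, ‖deriv (E t) x - ((∫ v in V, f t x v) - h x)‖ₑ ^ 2

def lossIC1 (f₀ : ℝ → ℝ → ℝ) (f : ℝ → ℝ → ℝ → ℝ) : ℝ≥0∞ :=
  ∫⁻ x in Ioo (-1) 1, ∫⁻ v in V, ‖f 0 x v - f₀ x v‖ₑ ^ 2

def lossIC2 (D : Set ℝ) (h : ℝ → ℝ) (f₀ : ℝ → ℝ → ℝ) (E : ℝ → ℝ → ℝ) : ℝ≥0∞ :=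
  ∫⁻ x in Ioo (-1) 1,
    ‖E 0 x - ((∫ y in (-1)..x, ∫ v in D, f₀ y v) - ∫ y in (-1)..x, h y)‖ₑ ^ 2

def lossBC1 (T : ℝ) (f : ℝ → ℝ → ℝ → ℝ) : ℝ≥0∞ :=
  ∫⁻ t in Ioo 0 T, ∑ x ∈ ({-1, 1} : Finset ℝ), ∫⁻ v in {v ∈ V | x * v < 0},
    ‖f t x v - f t x (-v)‖ₑ ^ 2

def lossBC2 (T : ℝ) (E : ℝ → ℝ → ℝ) : ℝ≥0∞ :=
  ∫⁻ t in Ioo 0 T, ∑ x ∈ ({-1, 1} : Finset ℝ), ‖E t x‖ₑ ^ 2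

/-- The total loss of the pair `(f, E)`, for the system with velocities in `D`. -/
def lossTotal (D : Set ℝ) (T : ℝ) (h : ℝ → ℝ) (f₀ : ℝ → ℝ → ℝ)
    (f : ℝ → ℝ → ℝ → ℝ) (E : ℝ → ℝ → ℝ) : ℝ≥0∞ :=
  (lossGE1 T f E + lossGE2 T h f E) + (lossIC1 f₀ f + lossIC2 D h f₀ E)
    + (lossBC1 T f + lossBC2 T E)

/-- The squared `L²` norm over `(0,T) × (-1,1)` of the mass `∫_{|v| > 10} f(t,x,v) dv` that the
velocity truncation ignores. -/
def truncationError (T : ℝ) (f : ℝ → ℝ → ℝ → ℝ) : ℝ≥0∞ :=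
  ∫⁻ t in Ioo 0 T, ∫⁻ x in Ioo (-1) 1, ‖∫ v in Vᶜ, f t x v‖ₑ ^ 2

end VPFP

end

/-! The loss is continuous in the quantities that it contains: `f`, its derivatives `∂ₜ`, `∂ₓ`,
`∂ᵥ`, `∂ᵥᵥ`, and `E`, `∂ₓE`. So it suffices to approximate all of these uniformly on compact sets by
networks. Every residual of the exact solution is zero except that of the Poisson equation: with
velocities in `D ⊇ V` the loss integrates over `V` only, and what remains is the mass in `D \ V`.
Both cases of the theorem are instances of `exists_tendsto_lossTotal`, for `D = V` and `D = univ`.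

Approximation takes two steps. First, polynomials: `exists_mvPolynomial_near_deriv` approximates a
function of anisotropic class `C^m` on a box by integrating approximations of its derivatives, one
variable at a time. For the field only `∂ₓE = ρ - h` is approximated and then integrated from `x =
-1`, where `E` vanishes; no regularity of `E` in `t` is needed beyond continuity of `ρ`.

Second, networks: by Hahn-Banach it is enough that a continuous functional `L` on the space of jets
(pure derivatives up to order two) that kills all ridge functions `σ(⟨w, z⟩ + b)` also kills
polynomials. Integrating in the bias `b` replaces `σ` by a smooth mollification `s`, which can be
chosen with `s⁽ᵐ⁾(b) ≠ 0` because `σ` is not a polynomial. Expanding `L` of the jet of `s(t⟨w, z⟩ +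
b)` in powers of `t` isolates `L` of the jet of `⟨w, z⟩ ^ m`, which must vanish; and powers of
linear forms span all polynomials. -/

namespace VPFP

/-! ### Simultaneous polynomial approximation of a function and its derivatives on a box. -/

section PolynomialApproximation

open MvPolynomial

variable {n : ℕ}

/-- The polynomial obtained by freezing the variable `i` at the value `a`. -/
noncomputable def freeze (i : Fin n) (a : ℝ) :
    MvPolynomial (Fin n) ℝ →ₐ[ℝ] MvPolynomial (Fin n) ℝ :=
  aeval (Function.update X i (C a))

theorem eval_freeze (i : Fin n) (a : ℝ) (P : MvPolynomial (Fin n) ℝ) (p : Fin n → ℝ) :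
    eval p (freeze i a P) = eval (Function.update p i a) P := by
  induction P using MvPolynomial.induction_on with
  | C r => simp [freeze]
  | add P Q hP hQ => simp [hP, hQ]
  | mul_X P j hP =>
    rw [map_mul, map_mul, map_mul, hP]
    congr 1
    rcases eq_or_ne j i with rfl | hj
    · simp [freeze]
    · simp [freeze, hj]

theorem pderiv_freeze_self (i : Fin n) (a : ℝ) (P : MvPolynomial (Fin n) ℝ) :
    pderiv i (freeze i a P) = 0 := by
  induction P using MvPolynomial.induction_on with
  | C r => simp [freeze]
  | add P Q hP hQ => simp [hP, hQ]
  | mul_X P j hP =>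
    rw [map_mul, pderiv_mul, hP, zero_mul, zero_add]
    rcases eq_or_ne j i with rfl | hj
    · simp [freeze]
    · simp [freeze, hj, pderiv_X_of_ne hj]

theorem pderiv_freeze_of_ne {i j : Fin n} (hij : j ≠ i) (a : ℝ) (P : MvPolynomial (Fin n) ℝ) :
    pderiv j (freeze i a P) = freeze i a (pderiv j P) := by
  induction P using MvPolynomial.induction_on with
  | C r => simp [freeze]
  | add P Q hP hQ => simp [hP, hQ]
  | mul_X P l hP =>
    rw [map_mul, pderiv_mul, hP, pderiv_mul, map_add, map_mul, map_mul]
    congr 2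
    rcases eq_or_ne l i with rfl | hl
    · simp [freeze, pderiv_X_of_ne hij.symm]
    · rcases eq_or_ne l j with rfl | hlj
      · simp [freeze, hl]
      · simp [freeze, hl, pderiv_X_of_ne hlj]

/-- The antiderivative in the variable `i` that vanishes where this variable is zero. -/
noncomputable def antideriv (i : Fin n) :
    MvPolynomial (Fin n) ℝ →ₗ[ℝ] MvPolynomial (Fin n) ℝ :=
  (basisMonomials (Fin n) ℝ).constr ℝ
    fun s => monomial (s + Finsupp.single i 1) (1 / ((s i : ℝ) + 1))

theorem antideriv_monomial (i : Fin n) (s : Fin n →₀ ℕ) (r : ℝ) :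
    antideriv i (monomial s r) = monomial (s + Finsupp.single i 1) (r / ((s i : ℝ) + 1)) := by
  have h : monomial s r = r • basisMonomials (Fin n) ℝ s := by
    simp [smul_monomial]
  rw [h, map_smul, antideriv, Module.Basis.constr_basis, smul_monomial]
  congr 1
  simp [div_eq_mul_inv]

theorem pderiv_antideriv_self (i : Fin n) (P : MvPolynomial (Fin n) ℝ) :
    pderiv i (antideriv i P) = P := by
  induction P using MvPolynomial.induction_on' with
  | monomial s r =>
    rw [antideriv_monomial, pderiv_monomial]
    have : ((s i : ℝ) + 1) ≠ 0 := by positivity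
    congr 1
    · simp
    · simp [this]
  | add P Q hP hQ => simp [hP, hQ]

theorem pderiv_antideriv_of_ne {i j : Fin n} (hij : j ≠ i) (P : MvPolynomial (Fin n) ℝ) :
    pderiv j (antideriv i P) = antideriv i (pderiv j P) := by
  induction P using MvPolynomial.induction_on' with
  | monomial s r =>
    rw [antideriv_monomial, pderiv_monomial, pderiv_monomial, antideriv_monomial]
    by_cases hs : s j = 0
    · simp [hs, hij.symm, hij]
    have : s + Finsupp.single i 1 - Finsupp.single j 1
        = s - Finsupp.single j 1 + Finsupp.single i 1 := by
      ext l
      rcases eq_or_ne l j with rfl | hl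
      · simp [hij]
      · simp [Finsupp.single_apply, hl.symm]
    rw [this]
    congr 1
    simp [hij]
    ring
  | add P Q hP hQ => simp [hP, hQ]

/-- The antiderivative in the variable `i` that vanishes where this variable is `a`. -/
noncomputable def antiderivFrom (i : Fin n) (a : ℝ) :
    MvPolynomial (Fin n) ℝ →ₗ[ℝ] MvPolynomial (Fin n) ℝ :=
  antideriv i - (freeze i a).toLinearMap ∘ₗ antideriv i

theorem pderiv_antiderivFrom_self (i : Fin n) (a : ℝ) (P : MvPolynomial (Fin n) ℝ) :
    pderiv i (antiderivFrom i a P) = P := by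
  simp [antiderivFrom, pderiv_antideriv_self, pderiv_freeze_self]

theorem pderiv_antiderivFrom_of_ne {i j : Fin n} (hij : j ≠ i) (a : ℝ)
    (P : MvPolynomial (Fin n) ℝ) :
    pderiv j (antiderivFrom i a P) = antiderivFrom i a (pderiv j P) := by
  simp [antiderivFrom, pderiv_antideriv_of_ne hij, pderiv_freeze_of_ne hij]

theorem hasDerivAt_eval_update (P : MvPolynomial (Fin n) ℝ) (i : Fin n) (p : Fin n → ℝ) (s : ℝ) :
    HasDerivAt (fun s => eval (Function.update p i s) P)
      (eval (Function.update p i s) (pderiv i P)) s := by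
  induction P using MvPolynomial.induction_on with
  | C r => simpa using hasDerivAt_const s r
  | add P Q hP hQ => simpa only [map_add] using! hP.add hQ
  | mul_X P j hP =>
    have hX : HasDerivAt (fun s => eval (Function.update p i s) (X j : MvPolynomial (Fin n) ℝ))
        (eval (Function.update p i s) (pderiv i (X j))) s := by
      rcases eq_or_ne j i with rfl | hj
      · simpa using hasDerivAt_id' s
      · simpa [hj, pderiv_X_of_ne hj] using hasDerivAt_const s (p j)
    have := hP.fun_mul hX
    simp only [map_mul, pderiv_mul, map_add]
    convert this using 1

theorem continuous_eval_update (P : MvPolynomial (Fin n) ℝ) (i : Fin n) (p : Fin n → ℝ) :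
    Continuous fun s => eval (Function.update p i s) P :=
  (MvPolynomial.continuous_eval P).comp (continuous_const.update i continuous_id)

theorem eval_antiderivFrom (i : Fin n) (a : ℝ) (P : MvPolynomial (Fin n) ℝ) (p : Fin n → ℝ) :
    eval p (antiderivFrom i a P) = ∫ s in a..p i, eval (Function.update p i s) P := by
  rw [intervalIntegral.integral_eq_sub_of_hasDerivAt (fun s _ =>
    by simpa [pderiv_antideriv_self] using hasDerivAt_eval_update (antideriv i P) i p s)
    ((continuous_eval_update P i p).intervalIntegrable _ _)]
  simp [antiderivFrom, eval_freeze]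

/-- Weierstrass approximation in several variables. -/
theorem exists_mvPolynomial_near {K : Set (Fin n → ℝ)} (hK : IsCompact K) {g : (Fin n → ℝ) → ℝ}
    (hg : ContinuousOn g K) {ε : ℝ} (hε : 0 < ε) :
    ∃ P : MvPolynomial (Fin n) ℝ, ∀ p ∈ K, |eval p P - g p| < ε := by
  have : CompactSpace K := isCompact_iff_compactSpace.mp hK
  let coord : Fin n → C(K, ℝ) := fun i => ⟨fun p => p.1 i, (continuous_apply i).comp continuous_subtype_val⟩
  let A : Subalgebra ℝ C(K, ℝ) := (aeval coord).range
  have hA : A.SeparatesPoints := by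
    intro p q hpq
    have : ∃ i, p.1 i ≠ q.1 i := by
      by_contra! h
      exact hpq (Subtype.ext (funext h))
    obtain ⟨i, hi⟩ := this
    exact ⟨_, ⟨coord i, ⟨X i, by simp⟩, rfl⟩, hi⟩
  obtain ⟨⟨_, P, rfl⟩, hP⟩ := ContinuousMap.exists_mem_subalgebra_near_continuous_of_separatesPoints
    A hA (fun p : K => g p) hg.domRestrict ε hε
  have heval : ∀ (P : MvPolynomial (Fin n) ℝ) (p : K), aeval coord P p = eval p.1 P := by
    intro P p
    induction P using MvPolynomial.induction_on with
    | C r => simp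
    | add P Q hP hQ => simp [hP, hQ]
    | mul_X P j hP => simp [hP, coord]
  refine ⟨P, fun p hp => ?_⟩
  have := hP ⟨p, hp⟩
  rw [Real.norm_eq_abs] at this
  rwa [← heval P ⟨p, hp⟩]

theorem update_mem_Icc {a b p : Fin n → ℝ} (hp : p ∈ Icc a b) {i : Fin n} {s : ℝ}
    (hs : s ∈ Icc (a i) (b i)) : Function.update p i s ∈ Icc a b := by
  constructor <;> intro j <;> rcases eq_or_ne j i with rfl | hj <;>
    simp_all [hp.1 j, hp.2 j]

/-- On a box, a function all of whose partial derivatives `D k` of multi-order `k ≤ m` are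
continuous is approximated uniformly by polynomials, together with these derivatives. -/
theorem exists_mvPolynomial_near_deriv {a b : Fin n → ℝ} (m : Fin n → ℕ)
    (D : (Fin n → ℕ) → (Fin n → ℝ) → ℝ)
    (hcont : ∀ k ≤ m, ContinuousOn (D k) (Icc a b))
    (hint : ∀ (k : Fin n → ℕ) (i : Fin n), k + Pi.single i 1 ≤ m → ∀ p ∈ Icc a b,
      D k p = D k (Function.update p i (a i))
        + ∫ s in a i..p i, D (k + Pi.single i 1) (Function.update p i s))
    {ε : ℝ} (hε : 0 < ε) :
    ∃ Q : (Fin n → ℕ) → MvPolynomial (Fin n) ℝ,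
      (∀ (k : Fin n → ℕ) (i : Fin n), k + Pi.single i 1 ≤ m →
        Q (k + Pi.single i 1) = pderiv i (Q k)) ∧
      ∀ k ≤ m, ∀ p ∈ Icc a b, |eval p (Q k) - D k p| < ε := by
  induction hN : ∑ i, m i using Nat.strong_induction_on generalizing m D ε with
  | _ N ih =>
  by_cases hm : m = 0
  · subst hm
    obtain ⟨P, hP⟩ := exists_mvPolynomial_near isCompact_Icc (hcont 0 le_rfl) hε
    refine ⟨fun _ => P, fun k i hk => ?_, fun k hk => ?_⟩
    · have := hk i
      simp at this
    · obtain rfl : k = 0 := le_antisymm hk (zero_le)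
      exact hP
  -- Pick a variable in which a derivative is available. The induction hypothesis serves twice: for
  -- the derivatives of `D e`, with orders up to `m - e`, and for the orders that do not involve the
  -- variable `i`.
  obtain ⟨i, hi⟩ : ∃ i, m i ≠ 0 := by
    by_contra! h
    exact hm (funext h)
  set e : Fin n → ℕ := Pi.single i 1 with he
  have hem : e ≤ m := by
    intro j
    rcases eq_or_ne j i with rfl | hj
    · simp [he]; omega
    · simp [he, hj]
  have he_i : e i = 1 := by simp [he]
  have he_ne : ∀ j, j ≠ i → e j = 0 := fun j hj => by simp [he, hj]
  have hle' : ∀ {k}, k ≤ m - e → k + e ≤ m := fun {k} hk => by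
    intro j
    have h1 := hk j
    have h2 := hem j
    simp only [Pi.add_apply, Pi.sub_apply] at *
    omega
  have hlt' : ∑ j, (m - e) j < N := by
    rw [← hN]
    refine Finset.sum_lt_sum (fun j _ => by simp) ⟨i, Finset.mem_univ _, ?_⟩
    simp only [Pi.sub_apply, he_i]; omega
  have hle0 : Function.update m i 0 ≤ m := by
    intro j
    rcases eq_or_ne j i with rfl | hj <;> simp [*]
  have hlt0 : ∑ j, (Function.update m i 0) j < N := by
    rw [← hN]
    refine Finset.sum_lt_sum (fun j _ => hle0 j) ⟨i, Finset.mem_univ _, ?_⟩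
    simp only [Function.update_self]; omega
  by_cases hne : (Icc a b).Nonempty
  swap
  · exact ⟨fun _ => 0, fun _ _ _ => by simp, fun k _ p hp => (hne ⟨p, hp⟩).elim⟩
  have hab : a i ≤ b i := by
    obtain ⟨p, hp⟩ := hne
    exact (hp.1 i).trans (hp.2 i)
  -- With this tolerance for the integrand, integration over a length at most `b i - a i` costs less
  -- than `ε / 2`; the `+ 1` covers a degenerate side.
  have hδ : 0 < ε / (2 * (b i - a i + 1)) := by
    have : 0 < b i - a i + 1 := by linarith
    positivity
  have hδε : ε / (2 * (b i - a i + 1)) * (b i - a i) < ε / 2 := by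
    have : 0 < b i - a i + 1 := by linarith
    rw [div_mul_eq_mul_div, div_lt_div_iff₀ (by positivity) (by norm_num)]
    nlinarith
  have hδε' : ε / (2 * (b i - a i + 1)) < ε := by
    have : 0 < b i - a i + 1 := by linarith
    rw [div_lt_iff₀ (by positivity)]
    nlinarith
  obtain ⟨Q₁, hQ₁, hQ₁D⟩ := ih _ hlt' (m - e) (fun k => D (k + e))
    (fun k hk => hcont _ (hle' hk))
    (fun k j hk p hp => by
      have := hint (k + e) j (by rw [add_right_comm]; exact hle' hk) p hp
      simpa only [add_right_comm k (Pi.single j 1) e] using this)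
    hδ rfl
  obtain ⟨Q₀, hQ₀, hQ₀D⟩ := ih _ hlt0 (Function.update m i 0) D
    (fun k hk => hcont _ (hk.trans hle0))
    (fun k j hk => hint k j (hk.trans hle0)) (half_pos hε) rfl
  -- The polynomial form of the fundamental theorem of calculus: the value of `Q₀` on the face where
  -- the `i`-th variable equals `a i`, plus the integral of `Q₁` from that face. One derivative in
  -- the variable `i` removes the first term and leaves `Q₁`.
  refine ⟨fun k => if k i = 0 then freeze i (a i) (Q₀ k) + antiderivFrom i (a i) (Q₁ k)
    else Q₁ (k - e), fun k j hk => ?_, fun k hk p hp => ?_⟩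
  · dsimp only
    rcases eq_or_ne j i with rfl | hj
    · rw [if_neg (by simp)]
      by_cases hk0 : k j = 0
      · rw [if_pos hk0, map_add, pderiv_freeze_self, zero_add, pderiv_antiderivFrom_self,
          ← he, add_tsub_cancel_right]
      · have hek : e ≤ k := by
          intro l
          rcases eq_or_ne l j with rfl | hl
          · rw [he_i]; exact Nat.one_le_iff_ne_zero.mpr hk0
          · simp [he_ne l hl]
        obtain ⟨k, rfl⟩ := exists_add_of_le hek
        rw [if_neg hk0, add_comm e k, add_tsub_cancel_right, add_tsub_cancel_right]
        refine hQ₁ k j ?_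
        rw [le_tsub_iff_right hem]
        rw [add_comm e k] at hk
        exact hk
    · have hij : (k + Pi.single j 1 : Fin n → ℕ) i = k i := by simp [hj.symm]
      simp only [hij]
      by_cases hk0 : k i = 0
      · have hk' : k + Pi.single j 1 ≤ m - e := by
          intro l
          have := hk l
          rcases eq_or_ne l i with rfl | hl
          · rw [hij, hk0]; exact Nat.zero_le _
          · simpa [he_ne l hl] using this
        have hk'' : k + Pi.single j 1 ≤ Function.update m i 0 := by
          intro l
          have := hk l
          rcases eq_or_ne l i with rfl | hl
          · rw [hij, hk0]; exact Nat.zero_le _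
          · simpa [hl] using this
        rw [if_pos hk0, if_pos hk0, hQ₁ k j hk', hQ₀ k j hk'', map_add, pderiv_freeze_of_ne hj,
          pderiv_antiderivFrom_of_ne hj]
      · have hek : e ≤ k := by
          intro l
          rcases eq_or_ne l i with rfl | hl
          · rw [he_i]; exact Nat.one_le_iff_ne_zero.mpr hk0
          · simp [he_ne l hl]
        obtain ⟨k, rfl⟩ := exists_add_of_le hek
        rw [if_neg hk0, if_neg hk0, add_assoc, add_tsub_cancel_left, add_tsub_cancel_left]
        refine hQ₁ k j ?_
        rw [le_tsub_iff_left hem, ← add_assoc]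
        exact hk
  · dsimp only
    by_cases hk0 : k i = 0
    · have hk' : k ≤ m - e := by
        intro l
        have := hk l
        rcases eq_or_ne l i with rfl | hl
        · rw [hk0]; exact Nat.zero_le _
        · simpa [he_ne l hl] using this
      have hk'' : k ≤ Function.update m i 0 := by
        intro l
        have := hk l
        rcases eq_or_ne l i with rfl | hl
        · rw [hk0]; exact Nat.zero_le _
        · simpa [hl] using this
      have hpi : p i ∈ Icc (a i) (b i) := ⟨hp.1 i, hp.2 i⟩
      have hsub : Set.uIcc (a i) (p i) ⊆ Icc (a i) (b i) := by
        rw [Set.uIcc_of_le hpi.1]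
        exact Icc_subset_Icc_right hpi.2
      have hDint : IntervalIntegrable (fun s => D (k + e) (Function.update p i s)) volume
          (a i) (p i) := by
        refine ContinuousOn.intervalIntegrable ?_
        refine (hcont _ (hle' hk')).comp 
          ((continuous_const (y := p)).update i continuous_id).continuousOn ?_
        exact fun s hs => update_mem_Icc hp (hsub hs)
      rw [if_pos hk0, map_add, eval_freeze, eval_antiderivFrom, hint k i (hle' hk') p hp,
        add_sub_add_comm, ← intervalIntegral.integral_sub
          ((continuous_eval_update _ i p).intervalIntegrable _ _) hDint]
      have h1 := hQ₀D k hk'' (Function.update p i (a i))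
        (update_mem_Icc hp (left_mem_Icc.mpr hab))
      have h2 : ‖∫ s in a i..p i, (eval (Function.update p i s) (Q₁ k)
          - D (k + e) (Function.update p i s))‖ ≤ ε / (2 * (b i - a i + 1)) * |p i - a i| := by
        refine intervalIntegral.norm_integral_le_of_norm_le_const fun s hs => ?_
        exact (hQ₁D k hk' _ (update_mem_Icc hp (hsub (uIoc_subset_uIcc hs)))).le
      rw [abs_of_nonneg (sub_nonneg.mpr hpi.1), Real.norm_eq_abs] at h2
      have h3 : ε / (2 * (b i - a i + 1)) * (p i - a i)
          ≤ ε / (2 * (b i - a i + 1)) * (b i - a i) :=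
        mul_le_mul_of_nonneg_left (by linarith [hpi.2]) hδ.le
      refine (abs_add_le _ _).trans_lt ?_
      linarith
    · have hek : e ≤ k := by
        intro l
        rcases eq_or_ne l i with rfl | hl
        · rw [he_i]; exact Nat.one_le_iff_ne_zero.mpr hk0
        · simp [he_ne l hl]
      obtain ⟨k, rfl⟩ := exists_add_of_le hek
      rw [if_neg hk0, add_tsub_cancel_left]
      have := hQ₁D k (by rw [le_tsub_iff_left hem]; exact hk) p hp
      rw [add_comm e k]
      exact this.trans hδε'

end PolynomialApproximation

end VPFP

namespace VPFP

/-! ### Mollifications of a nonpolynomial function, and polynomials that are small at the origin. -/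

section Mollification

open Polynomial ContDiff
open scoped Convolution

/-- A smooth function whose derivative of order `m` vanishes is a polynomial of degree `< m`. -/
theorem exists_polynomial_of_iteratedDeriv_eq_zero (m : ℕ) {g : ℝ → ℝ} (hg : ContDiff ℝ ∞ g)
    (h : ∀ x, iteratedDeriv m g x = 0) :
    ∃ P : ℝ[X], P.degree < m ∧ ∀ x, g x = P.eval x := by
  rcases m with _ | n
  · exact ⟨0, by simp, fun x => by simpa using h x⟩
  refine ⟨∑ k ∈ Finset.range (n + 1), Polynomial.C ((k.factorial : ℝ)⁻¹ * iteratedDeriv k g 0)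
    * Polynomial.X ^ k, ?_, fun x => ?_⟩
  · refine (degree_sum_le _ _).trans_lt ?_
    rw [Finset.sup_lt_iff (by exact WithBot.bot_lt_coe _)]
    intro k hk
    refine (degree_C_mul_X_pow_le k _).trans_lt ?_
    exact_mod_cast Finset.mem_range.mp hk
  · rcases eq_or_ne 0 x with rfl | hx
    · rw [Finset.sum_range_succ']
      simp [eval_finsetSum]
    -- The Lagrange remainder contains the derivative of order `n + 1`, which is zero, so `g` equals
    -- its Taylor polynomial at `0`.
    obtain ⟨x', -, hx'⟩ := taylor_mean_remainder_lagrange_iteratedDeriv (n := n) hx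
      (hg.contDiffOn.of_le (mod_cast le_top))
    rw [h, zero_mul, zero_div, sub_eq_zero] at hx'
    rw [hx', taylor_within_apply, eval_finsetSum]
    refine Finset.sum_congr rfl fun k _ => ?_
    rw [iteratedDerivWithin_eq_iteratedDeriv (uniqueDiffOn_uIcc hx)
      (hg.contDiffAt.of_le (mod_cast le_top)) left_mem_uIcc]
    simp
    ring

/-- A pointwise limit of polynomials of degree `< m` is a polynomial. -/
theorem exists_polynomial_of_tendsto (m : ℕ) {P : ℕ → ℝ[X]} (hP : ∀ j, (P j).degree < m)
    {g : ℝ → ℝ} (h : ∀ x, Tendsto (fun j => (P j).eval x) atTop (𝓝 (g x))) :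
    ∃ Q : ℝ[X], ∀ x, g x = Q.eval x := by
  -- Degree `< m` makes each polynomial its own interpolant at the nodes `0, …, m - 1`; convergence
  -- at these nodes then identifies the limit as the interpolant of `g`.
  let v : ℕ → ℝ := fun i => i
  have hv : Set.InjOn v (Finset.range m) := fun _ _ _ _ hij => Nat.cast_injective hij
  refine ⟨Lagrange.interpolate (Finset.range m) v fun i => g (v i), fun x => ?_⟩
  refine tendsto_nhds_unique (h x) ?_
  have hPj : ∀ j, (P j).eval x
      = ∑ i ∈ Finset.range m, (P j).eval (v i) * (Lagrange.basis (Finset.range m) v i).eval x := by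
    intro j
    conv_lhs => rw [Lagrange.eq_interpolate hv (f := P j) (by simpa using hP j)]
    simp [Lagrange.interpolate_apply, eval_finsetSum]
  simp only [hPj, Lagrange.interpolate_apply, eval_finsetSum, eval_mul, eval_C]
  exact tendsto_finsetSum _ fun i _ => (h (v i)).mul_const _

/-- The mollification of `g` by `φ`. -/
noncomputable def mollify (φ g : ℝ → ℝ) (x : ℝ) : ℝ := ∫ t, φ t * g (x - t)

theorem mollify_eq_convolution (φ g : ℝ → ℝ) :
    mollify φ g = φ ⋆[ContinuousLinearMap.lsmul ℝ ℝ, volume] g := by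
  ext x
  simp [mollify, convolution]

theorem contDiff_mollify {φ g : ℝ → ℝ} (hφ : ContDiff ℝ ∞ φ) (hc : HasCompactSupport φ)
    (hg : Continuous g) : ContDiff ℝ ∞ (mollify φ g) := by
  rw [mollify_eq_convolution]
  exact hc.contDiff_convolution_left _ hφ hg.locallyIntegrable

/-- The derivative first falls on the smooth factor `φ`; integration by parts moves it to `g`,
without boundary terms since `φ` has compact support. -/
theorem deriv_mollify {φ g : ℝ → ℝ} (hφ : ContDiff ℝ ∞ φ) (hc : HasCompactSupport φ)
    (hg : ContDiff ℝ 1 g) : deriv (mollify φ g) = mollify φ (deriv g) := by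
  ext x
  have hg' : Continuous (deriv g) := hg.continuous_deriv le_rfl
  have hφ' : Continuous (deriv φ) := hφ.continuous_deriv (by simp)
  have h1 : HasDerivAt (mollify φ g) (∫ t, deriv φ t * g (x - t)) x := by
    rw [mollify_eq_convolution]
    have := hc.hasDerivAt_convolution_left (ContinuousLinearMap.lsmul ℝ ℝ)
      (hφ.of_le (by simp)) (hg.continuous.locallyIntegrable (μ := volume)) x
    simpa [convolution] using this
  rw [h1.deriv]
  have hsub : Continuous fun t : ℝ => x - t := by fun_prop
  have h2 := integral_mul_deriv_eq_deriv_mul_of_integrable (u := φ) (u' := deriv φ)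
    (v := fun t => g (x - t)) (v' := fun t => -deriv g (x - t))
    (fun t _ => (hφ.differentiable (by simp)).differentiableAt.hasDerivAt)
    (fun t _ => by
      simpa using ((hg.differentiable (by simp)).differentiableAt.hasDerivAt
        (x := x - t)).comp_const_sub x t)
    ((hφ.continuous.mul (hg'.comp hsub).neg).integrable_of_hasCompactSupport hc.mul_right)
    ((hφ'.mul (hg.continuous.comp hsub)).integrable_of_hasCompactSupport hc.deriv.mul_right)
    ((hφ.continuous.mul (hg.continuous.comp hsub)).integrable_of_hasCompactSupport hc.mul_right)
  simp only [mul_neg, integral_neg, neg_inj] at h2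
  rw [mollify, h2]

theorem iteratedDeriv_mollify {φ : ℝ → ℝ} (hφ : ContDiff ℝ ∞ φ) (hc : HasCompactSupport φ)
    (k : ℕ) {g : ℝ → ℝ} (hg : ContDiff ℝ k g) :
    iteratedDeriv k (mollify φ g) = mollify φ (iteratedDeriv k g) := by
  induction k generalizing g with
  | zero => simp
  | succ k ih =>
    have hg1 : ContDiff ℝ 1 g := hg.of_le (by norm_cast; omega)
    have hg2 : ContDiff ℝ k (deriv g) := by
      have : ContDiff ℝ ((k : WithTop ℕ∞) + 1) g := by exact_mod_cast hg
      exact (contDiff_succ_iff_deriv.mp this).2.2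
    rw [iteratedDeriv_succ', iteratedDeriv_succ', deriv_mollify hφ hc hg1, ih hg2]

/-- A continuous function that is not a polynomial has, for each `m`, a mollification whose
derivative of order `m` does not vanish identically. -/
theorem exists_iteratedDeriv_mollify_ne_zero {g : ℝ → ℝ} (hg : Continuous g)
    (hpoly : ¬ ∃ P : ℝ[X], ∀ s : ℝ, g s = P.eval s) (m : ℕ) :
    ∃ φ : ℝ → ℝ, ContDiff ℝ ∞ φ ∧ HasCompactSupport φ ∧
      ∃ b, iteratedDeriv m (mollify φ g) b ≠ 0 := by
  -- Otherwise every mollification is a polynomial of degree `< m`. Mollifying with bumps that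
  -- shrink to the origin recovers `g` as a pointwise limit, and the uniform degree bound makes `g`
  -- a polynomial.
  by_contra! hcon
  apply hpoly
  let ψ : ℕ → ContDiffBump (0 : ℝ) := fun j =>
    ⟨1 / (2 * ((j : ℝ) + 1)), 1 / ((j : ℝ) + 1), by positivity, by
      apply one_div_lt_one_div_of_lt <;> nlinarith [(Nat.cast_nonneg j : (0 : ℝ) ≤ j)]⟩
  have hψ : ∀ j, ∃ P : ℝ[X], P.degree < m ∧
      ∀ x, mollify ((ψ j).normed volume) g x = P.eval x := fun j =>
    exists_polynomial_of_iteratedDeriv_eq_zero m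
      (contDiff_mollify (ψ j).contDiff_normed (ψ j).hasCompactSupport_normed hg)
      (hcon _ (ψ j).contDiff_normed (ψ j).hasCompactSupport_normed)
  choose P hPdeg hP using hψ
  refine exists_polynomial_of_tendsto m hPdeg fun x => ?_
  simp only [← hP, mollify_eq_convolution]
  exact ContDiffBump.convolution_tendsto_right_of_continuous
    tendsto_one_div_add_atTop_nhds_zero_nat hg x

/-- A polynomial of degree at most `N` that is `o(x ^ N)` at the origin vanishes. -/
theorem coeff_eq_zero_of_isLittleO (N : ℕ) (a : ℕ → ℝ)
    (h : (fun x : ℝ => ∑ j ∈ Finset.range (N + 1), a j * x ^ j) =o[𝓝 0] fun x => x ^ N) :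
    ∀ j ≤ N, a j = 0 := by
  induction N generalizing a with
  | zero =>
    intro j hj
    obtain rfl : j = 0 := by omega
    simpa using h
  | succ N ih =>
    have h0 : a 0 = 0 := by
      have h1 : Tendsto (fun x : ℝ => ∑ j ∈ Finset.range (N + 1 + 1), a j * x ^ j) (𝓝 0) (𝓝 0) := by
        refine (h.trans_tendsto ?_)
        exact (continuous_pow (N + 1)).tendsto' 0 0 (by simp)
      have h2 : Tendsto (fun x : ℝ => ∑ j ∈ Finset.range (N + 1 + 1), a j * x ^ j) (𝓝 0)
          (𝓝 (a 0)) := by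
        refine Continuous.tendsto' (by fun_prop) _ _ ?_
        rw [Finset.sum_range_succ']
        simp
      exact tendsto_nhds_unique h2 h1
    have h3 := ih (fun j => a (j + 1)) (by
      refine Asymptotics.IsLittleO.of_bound fun c hc => ?_
      have hx0 : ∀ᶠ x in 𝓝[≠] (0 : ℝ), ‖∑ j ∈ Finset.range (N + 1), a (j + 1) * x ^ j‖
          ≤ c * ‖x ^ N‖ := by
        filter_upwards [nhdsWithin_le_nhds (h.bound hc), self_mem_nhdsWithin] with x hx hx0
        rw [Finset.sum_range_succ', h0, zero_mul, add_zero] at hx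
        have hxs : ∑ j ∈ Finset.range (N + 1), a (j + 1) * x ^ (j + 1)
            = x * ∑ j ∈ Finset.range (N + 1), a (j + 1) * x ^ j := by
          rw [Finset.mul_sum]
          exact Finset.sum_congr rfl fun j _ => by ring
        rw [hxs, pow_succ', norm_mul, norm_mul, mul_left_comm] at hx
        exact le_of_mul_le_mul_left hx (norm_pos_iff.mpr hx0)
      -- Division by `x` gives the bound only off the origin; as a closed condition it extends to
      -- the origin.
      have hcl : IsClosed {x : ℝ | ‖∑ j ∈ Finset.range (N + 1), a (j + 1) * x ^ j‖
          ≤ c * ‖x ^ N‖} := isClosed_le (by fun_prop) (by fun_prop)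
      rw [← nhdsNE_sup_pure, eventually_sup]
      refine ⟨hx0, ?_⟩
      have := hcl.mem_of_frequently_of_tendsto (b := 𝓝[≠] (0 : ℝ)) (f := id) hx0.frequently
        (tendsto_id.mono_left nhdsWithin_le_nhds)
      exact this)
    intro j hj
    rcases j with _ | j
    · exact h0
    · exact h3 j (by omega)

end Mollification

end VPFP

namespace VPFP

/-! ### Density of shallow networks in the polynomials, with pure derivatives up to order two. -/

section NetworkDensity

open ContDiff

variable {n : ℕ}

/-- The ridge function `z ↦ g (⟨w, z⟩ + b)` on a compact set. -/
def ridge (K : Set (Fin n → ℝ)) (g : C(ℝ, ℝ)) (w : Fin n → ℝ) (b : ℝ) : C(K, ℝ) :=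
  ⟨fun z => g ((∑ j, w j * z.1 j) + b), by
    refine g.continuous.comp ((continuous_finsetSum _ fun j _ => ?_).add continuous_const)
    exact continuous_const.mul ((continuous_apply j).comp continuous_subtype_val)⟩

/-- The pure partial derivatives of order at most two of a ridge function, where `G k` is the
derivative of order `k` of the profile. -/
def ridgeJet (K : Set (Fin n → ℝ)) (G : Fin 3 → C(ℝ, ℝ)) (w : Fin n → ℝ) (b : ℝ) :
    Fin n × Fin 3 → C(K, ℝ) :=
  fun q => w q.1 ^ (q.2 : ℕ) • ridge K (G q.2) w b

/-- The pure partial derivatives of order at most two of `z ↦ ⟨w, z⟩ ^ m`. -/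
def powJet (K : Set (Fin n → ℝ)) (w : Fin n → ℝ) (m : ℕ) : Fin n × Fin 3 → C(K, ℝ) :=
  fun q => ((m.descFactorial q.2 : ℝ) * w q.1 ^ (q.2 : ℕ)) •
    ridge K ⟨fun y => y ^ (m - (q.2 : ℕ)), by fun_prop⟩ w 0

theorem ridgeJet_apply (K : Set (Fin n → ℝ)) (G : Fin 3 → C(ℝ, ℝ)) (w : Fin n → ℝ) (b : ℝ)
    (q : Fin n × Fin 3) (z : K) :
    ridgeJet K G w b q z = w q.1 ^ (q.2 : ℕ) * G q.2 ((∑ j, w j * z.1 j) + b) := rfl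

theorem powJet_apply (K : Set (Fin n → ℝ)) (w : Fin n → ℝ) (m : ℕ) (q : Fin n × Fin 3) (z : K) :
    powJet K w m q z = ((m.descFactorial q.2 : ℝ) * w q.1 ^ (q.2 : ℕ)) *
      ((∑ j, w j * z.1 j) + 0) ^ (m - (q.2 : ℕ)) := rfl

variable {K : Set (Fin n → ℝ)}

open MvPolynomial in
/-- The pure partial derivatives of order at most two of a polynomial. -/
noncomputable def polyJet (K : Set (Fin n → ℝ)) :
    MvPolynomial (Fin n) ℝ →ₗ[ℝ] (Fin n × Fin 3 → C(K, ℝ)) :=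
  LinearMap.pi fun q =>
    { toFun := fun P => ⟨fun z => eval z.1 ((pderiv q.1)^[q.2] P),
        (MvPolynomial.continuous_eval _).comp continuous_subtype_val⟩
      map_add' := fun P Q => by
        ext z
        simp [iterate_map_add]
      map_smul' := fun r P => by
        ext z
        have : (pderiv q.1)^[q.2] (r • P) = r • (pderiv q.1)^[q.2] P := by
          generalize (q.2 : ℕ) = k
          induction k with
          | zero => rfl
          | succ k ih => rw [Function.iterate_succ_apply', ih, Derivation.map_smul,
              Function.iterate_succ_apply']
        simp [this, smul_eval] }

open MvPolynomial in
theorem polyJet_pow (w : Fin n → ℝ) (m : ℕ) :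
    polyJet K ((∑ j, C (w j) * X j) ^ m) = powJet K w m := by
  have hd : ∀ i, pderiv i (∑ j, C (w j) * X j : MvPolynomial (Fin n) ℝ) = C (w i) := by
    intro i
    simp [pderiv_X, Pi.single_apply]
  have hk : ∀ (i : Fin n) (k : ℕ), (pderiv i)^[k] ((∑ j, C (w j) * X j) ^ m)
      = C ((m.descFactorial k : ℝ) * w i ^ k) * (∑ j, C (w j) * X j) ^ (m - k) := by
    intro i k
    induction k with
    | zero => simp
    | succ k ih =>
      rw [Function.iterate_succ_apply', ih, pderiv_C_mul, pderiv_pow, hd, Nat.descFactorial_succ,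
        Nat.sub_sub]
      simp only [map_mul, map_pow, Nat.cast_mul, map_natCast]
      ring
  ext q z
  simp [polyJet, powJet, ridge, hk]

theorem continuous_ridgeJet (G : Fin 3 → C(ℝ, ℝ)) (w : Fin n → ℝ) :
    Continuous (ridgeJet K G w) := by
  refine continuous_pi fun q => ?_
  change Continuous fun b => w q.1 ^ (q.2 : ℕ) • ridge K (G q.2) w b
  refine Continuous.const_smul (ContinuousMap.continuous_of_continuous_uncurry
    (fun b => ridge K (G q.2) w b) ?_) (w q.1 ^ (q.2 : ℕ))
  change Continuous fun p : ℝ × K => G q.2 ((∑ j, w j * p.2.1 j) + p.1)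
  have hj : ∀ j, Continuous fun p : ℝ × K => w j * p.2.1 j := fun j =>
    continuous_const.mul ((continuous_apply j).comp
      (continuous_subtype_val.comp (continuous_snd (X := ℝ) (Y := K))))
  exact (G q.2).continuous.comp ((continuous_finsetSum _ fun j _ => hj j).add
    continuous_fst)

variable [CompactSpace K]

/-- Mollifying the profile is averaging over translates of the bias, so the new jet is a Bochner
integral of jets killed by `L`, and `L` passes under the integral. -/
theorem map_ridgeJet_mollify {L : (Fin n × Fin 3 → C(K, ℝ)) →L[ℝ] ℝ} {G : Fin 3 → C(ℝ, ℝ)}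
    {w : Fin n → ℝ} (hL : ∀ b, L (ridgeJet K G w b) = 0) {φ : ℝ → ℝ} (hφ : Continuous φ)
    (hc : HasCompactSupport φ) {H : Fin 3 → C(ℝ, ℝ)} (hH : ∀ k x, H k x = mollify φ (G k) x)
    (b : ℝ) : L (ridgeJet K H w b) = 0 := by
  have hcont : Continuous fun t => φ t • ridgeJet K G w (b - t) :=
    hφ.smul ((continuous_ridgeJet G w).comp (continuous_const.sub continuous_id))
  have hint : Integrable fun t => φ t • ridgeJet K G w (b - t) :=
    hcont.integrable_of_hasCompactSupport hc.smul_right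
  have key : ridgeJet K H w b = ∫ t, φ t • ridgeJet K G w (b - t) := by
    ext q z
    let ev : (Fin n × Fin 3 → C(K, ℝ)) →L[ℝ] ℝ :=
      (ContinuousMap.evalCLM ℝ z).comp (ContinuousLinearMap.proj q)
    have h1 : (∫ t, φ t • ridgeJet K G w (b - t)) q z
        = ∫ t, ev (φ t • ridgeJet K G w (b - t)) := (ev.integral_comp_comm hint).symm
    rw [h1]
    simp only [ridgeJet_apply, hH, mollify]
    rw [← integral_const_mul]
    refine integral_congr_ae (Eventually.of_forall fun t => ?_)
    simp only [ev, ContinuousLinearMap.coe_comp, Function.comp_apply,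
      ContinuousLinearMap.proj_apply, ContinuousMap.evalCLM_apply, Pi.smul_apply,
      ContinuousMap.coe_smul, smul_eq_mul, ridgeJet_apply, add_sub_assoc]
    ring
  rw [key, ← L.integral_comp_comm hint]
  simp [hL]

/-- Taylor expansion of `t ↦ s (t ⟨w, z⟩ + b)` at the origin, uniformly in `z` and together with
the derivatives of order at most two in `z`. -/
theorem ridgeJet_taylor {s : ℝ → ℝ} (hs : ContDiff ℝ ∞ s) {S : Fin 3 → C(ℝ, ℝ)}
    (hS : ∀ (k : Fin 3) x, S k x = iteratedDeriv k s x) (w : Fin n → ℝ) (b : ℝ) {N : ℕ}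
    (hN : 2 ≤ N) :
    (fun t : ℝ => ridgeJet K S (t • w) b - ∑ j ∈ Finset.range (N + 1),
      (t ^ j * iteratedDeriv j s b / j.factorial) • powJet K w j) =o[𝓝 0] fun t => t ^ N := by
  rw [Asymptotics.isLittleO_pi]
  intro q
  obtain ⟨i, k⟩ := q
  have hkN : (k : ℕ) ≤ N := by have := k.2; omega
  -- The component of order `k` carries a factor `t ^ k`, so expanding the `k`-th derivative of `s`
  -- to order `M = N - k` gives an error `o(t ^ N)`.
  obtain ⟨M, rfl⟩ := Nat.exists_eq_add_of_le hkN
  let y : C(K, ℝ) := ridge K ⟨fun y => y, continuous_id⟩ w 0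
  have hy : ∀ z : K, y z = ∑ j, w j * z.1 j := fun z => by simp [y, ridge]
  set R := ‖y‖ + 1 with hR
  have hR0 : 0 < R := by positivity
  have hyR : ∀ z, |y z| ≤ R := fun z => (y.norm_coe_le_norm z).trans (by linarith)
  refine Asymptotics.IsLittleO.of_bound fun c hc => ?_
  -- `B` absorbs the factor `|w i| ^ k * R ^ M` of the final error; the `+ 1` keeps it positive.
  obtain ⟨B, hB⟩ : ∃ B, B = |w i| ^ (k : ℕ) * R ^ M + 1 := ⟨_, rfl⟩
  have hB0 : 0 < B := by rw [hB]; positivity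
  have hB' : |w i| ^ (k : ℕ) * R ^ M = B - 1 := by simp [hB]
  have hsk : ContDiff ℝ ∞ (iteratedDeriv k s) := by
    rw [iteratedDeriv_eq_iterate]
    exact ContDiff.iterate_deriv k hs
  have htay := (taylor_isLittleO_univ (x₀ := b) (n := M) (hsk.of_le (mod_cast le_top))).bound
    (div_pos hc hB0)
  rw [Metric.eventually_nhds_iff] at htay
  obtain ⟨δ, hδ, htay⟩ := htay
  filter_upwards [Metric.ball_mem_nhds (0 : ℝ) (div_pos hδ hR0)] with t ht
  rw [mem_ball_zero_iff, Real.norm_eq_abs, lt_div_iff₀ hR0] at ht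
  rw [ContinuousMap.norm_le _ (by positivity)]
  intro z
  have hyz : |t * y z| ≤ |t| * R := by
    rw [abs_mul]; exact mul_le_mul_of_nonneg_left (hyR z) (abs_nonneg t)
  have hT := htay (y := t * y z + b) (by
    rw [Real.dist_eq, add_sub_cancel_right]; exact hyz.trans_lt ht)
  rw [add_sub_cancel_right, taylor_within_apply] at hT
  have hval : (ridgeJet K S (t • w) b - ∑ j ∈ Finset.range ((k : ℕ) + M + 1),
      (t ^ j * iteratedDeriv j s b / j.factorial) • powJet K w j) (i, k) z
      = (t * w i) ^ (k : ℕ) * (iteratedDeriv k s (t * y z + b) -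
        ∑ l ∈ Finset.range (M + 1), ((l.factorial : ℝ)⁻¹ * (t * y z + b - b) ^ l) •
          iteratedDerivWithin l (iteratedDeriv k s) univ b) := by
    have harg : ∑ j, t * w j * z.1 j = t * y z := by
      rw [hy, Finset.mul_sum]; exact Finset.sum_congr rfl fun j _ => by ring
    simp only [Pi.sub_apply, Finset.sum_apply, Pi.smul_apply, ContinuousMap.sub_apply,
      ContinuousMap.coe_sum, ContinuousMap.coe_smul, ridgeJet_apply, powJet_apply, smul_eq_mul, hS, harg, ← hy, add_zero, mul_sub, add_sub_cancel_right]
    congr 1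
    -- Terms with `j < k` vanish, since `k` derivatives kill a power below `k`; the others are
    -- reindexed by `j = k + l`.
    rw [add_assoc, Finset.sum_range_add, Finset.sum_eq_zero, zero_add, Finset.mul_sum]
    · refine Finset.sum_congr rfl fun l _ => ?_
      rw [iteratedDerivWithin_univ, iteratedDeriv_eq_iterate, iteratedDeriv_eq_iterate,
        iteratedDeriv_eq_iterate, ← Function.iterate_add_apply, add_comm l,
        Nat.add_sub_cancel_left]
      have hd : ((((k : ℕ) + l).descFactorial k : ℕ) : ℝ) * (l.factorial : ℝ)
          = (((k : ℕ) + l).factorial : ℝ) := by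
        have := Nat.factorial_mul_descFactorial (Nat.le_add_right (k : ℕ) l)
        rw [Nat.add_sub_cancel_left] at this
        rw [mul_comm]
        exact_mod_cast this
      have h1 : (l.factorial : ℝ) ≠ 0 := by positivity
      have h2 : (((k : ℕ) + l).factorial : ℝ) ≠ 0 := by positivity
      field_simp
      rw [← hd]
      ring
    · intro j hj
      rw [Nat.descFactorial_of_lt (Finset.mem_range.mp hj)]
      simp
  rw [hval]
  rw [Real.norm_eq_abs] at hT ⊢
  rw [add_sub_cancel_right] at hT ⊢
  rw [abs_mul, abs_pow, abs_mul, norm_pow, Real.norm_eq_abs]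
  rw [norm_pow, Real.norm_eq_abs] at hT
  calc (|t| * |w i|) ^ (k : ℕ) * _
      ≤ (|t| * |w i|) ^ (k : ℕ) * (c / B * (|t| * R) ^ M) := by
        refine mul_le_mul_of_nonneg_left (hT.trans ?_) (by positivity)
        gcongr
    _ = c * |t| ^ ((k : ℕ) + M) * ((B - 1) / B) := by
        rw [← hB', mul_pow, mul_pow, pow_add]
        ring
    _ ≤ c * |t| ^ ((k : ℕ) + M) * 1 := by
        refine mul_le_mul_of_nonneg_left ?_ (by positivity)
        rw [div_le_one hB0]; linarith
    _ = _ := mul_one _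

/-- The derivative of order `k ≤ 2` of a `C²` function, as a continuous map. -/
noncomputable def derivMap {σ : ℝ → ℝ} (hσ : ContDiff ℝ 2 σ) (k : Fin 3) : C(ℝ, ℝ) :=
  ⟨iteratedDeriv k σ, hσ.continuous_iteratedDeriv k (by
    have := k.2
    exact_mod_cast (by omega : (k : ℕ) ≤ 2))⟩

/-- For the mollified profile, `L` vanishes on the jet with weight `t • w` for every `t`. Applying
`L` to the Taylor expansion in `t` leaves a polynomial in `t` that is negligible beyond its degree,
so all its coefficients are zero. The one at `m` is `L (powJet K w m)` times a nonzero number. -/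
theorem map_powJet_eq_zero {σ : ℝ → ℝ} (hσ : ContDiff ℝ 2 σ)
    (hpoly : ¬ ∃ P : Polynomial ℝ, ∀ s : ℝ, σ s = P.eval s)
    {L : (Fin n × Fin 3 → C(K, ℝ)) →L[ℝ] ℝ}
    (hL : ∀ w b, L (ridgeJet K (derivMap hσ) w b) = 0) (w : Fin n → ℝ) (m : ℕ) :
    L (powJet K w m) = 0 := by
  obtain ⟨φ, hφ, hc, b, hb⟩ := exists_iteratedDeriv_mollify_ne_zero hσ.continuous hpoly m
  have hs := contDiff_mollify hφ hc hσ.continuous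
  let S : Fin 3 → C(ℝ, ℝ) := fun k => ⟨iteratedDeriv k (mollify φ σ),
    hs.continuous_iteratedDeriv k (mod_cast le_top)⟩
  have hS : ∀ w, L (ridgeJet K S w b) = 0 := fun w => by
    refine map_ridgeJet_mollify (hL w) hφ.continuous hc (fun k x => ?_) b
    have hk : ContDiff ℝ ((k : ℕ) : WithTop ℕ∞) σ := hσ.of_le (by
      have := k.2
      exact_mod_cast (by omega : (k : ℕ) ≤ 2))
    exact congrFun (iteratedDeriv_mollify hφ hc k hk) x
  have htay := ridgeJet_taylor (K := K) hs (S := S) (fun _ _ => rfl) w b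
    (Nat.le_add_left 2 m)
  -- Order `m + 2` rather than `m`, because the expansion of the jet requires order at least two.
  have h0 := coeff_eq_zero_of_isLittleO (m + 2)
    (fun j => L (powJet K w j) * (iteratedDeriv j (mollify φ σ) b / j.factorial)) (by
      have := (L.isBigO_comp _ (𝓝 0)).trans_isLittleO htay
      simp only [map_sub, hS, map_sum, map_smul, zero_sub, smul_eq_mul] at this
      refine this.neg_left.congr_left fun t => ?_
      rw [neg_neg]
      exact Finset.sum_congr rfl fun j _ => by ring) m (by omega)
  have hf : (m.factorial : ℝ) ≠ 0 := by positivity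
  simpa [hb, hf] using h0

open MvPolynomial in
/-- The powers of linear forms span the polynomials. -/
theorem linearMap_eq_zero_of_pow (ℓ : MvPolynomial (Fin n) ℝ →ₗ[ℝ] ℝ)
    (h : ∀ (w : Fin n → ℝ) (m : ℕ), ℓ ((∑ j, C (w j) * X j) ^ m) = 0) : ℓ = 0 := by
  refine (basisMonomials (Fin n) ℝ).ext fun s => ?_
  rw [coe_basisMonomials, LinearMap.zero_apply]
  let m := ∑ j, s j
  -- By the multinomial theorem, `P` at `w` is `ℓ` of the `m`-th power of the linear form with
  -- coefficients `w`. Hence `P` vanishes, and its coefficient at `s` is a positive multinomial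
  -- coefficient times `ℓ` of the monomial `s`.
  let P : MvPolynomial (Fin n) ℝ := ∑ k ∈ Finset.piAntidiag Finset.univ m,
    C ((Nat.multinomial Finset.univ k : ℝ) * ℓ (∏ j, X j ^ k j)) * ∏ j, X j ^ k j
  have hP : P = 0 := by
    refine MvPolynomial.funext fun w => ?_
    rw [map_zero, ← h w m, Finset.sum_pow_eq_sum_piAntidiag, map_sum, map_sum]
    refine Finset.sum_congr rfl fun k _ => ?_
    have : (Nat.multinomial Finset.univ k : MvPolynomial (Fin n) ℝ)
        * ∏ j, (C (w j) * X j) ^ k j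
        = ((Nat.multinomial Finset.univ k : ℝ) * ∏ j, w j ^ k j) • ∏ j, X j ^ k j := by
      simp only [mul_pow, Finset.prod_mul_distrib, ← map_pow, ← map_prod, smul_eq_C_mul, map_mul,
        map_natCast]
      ring
    rw [this, map_smul]
    simp
    ring
  have hcoef : ∀ k : Fin n → ℕ, (∏ j, X j ^ k j : MvPolynomial (Fin n) ℝ)
      = monomial (Finsupp.equivFunOnFinite.symm k) 1 := by
    intro k
    rw [monomial_eq, C_1, one_mul, Finsupp.prod_fintype _ _ (by simp)]
    rfl
  have hs : coeff s P = (Nat.multinomial Finset.univ (s : Fin n → ℕ) : ℝ) * ℓ (monomial s 1) := by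
    simp only [P, coeff_sum, coeff_C_mul, hcoef]
    rw [Finset.sum_eq_single (s : Fin n → ℕ)]
    · simp
    · intro k _ hk
      rw [coeff_monomial, if_neg, mul_zero]
      rintro rfl
      exact hk rfl
    · intro hs
      exact absurd (by simp [Finset.mem_piAntidiag, m]) hs
  rw [hP, coeff_zero] at hs
  have hm : (Nat.multinomial Finset.univ (s : Fin n → ℕ) : ℝ) ≠ 0 := by
    exact_mod_cast (Nat.multinomial_pos _ _).ne'
  simpa [hm] using hs.symm

/-- By Hahn-Banach, a polynomial jet outside the closed span would be separated from it by a
functional that kills every ridge jet. Such a functional kills all jets of powers of linear forms,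
hence all polynomial jets. -/
theorem polyJet_mem_closure {σ : ℝ → ℝ} (hσ : ContDiff ℝ 2 σ)
    (hpoly : ¬ ∃ P : Polynomial ℝ, ∀ s : ℝ, σ s = P.eval s) (P : MvPolynomial (Fin n) ℝ) :
    polyJet K P ∈ (Submodule.span ℝ
      (range fun q : (Fin n → ℝ) × ℝ => ridgeJet K (derivMap hσ) q.1 q.2)).topologicalClosure := by
  set W := Submodule.span ℝ
    (range fun q : (Fin n → ℝ) × ℝ => ridgeJet K (derivMap hσ) q.1 q.2) with hW
  by_contra hcon
  obtain ⟨L, u, hLu, hLW⟩ := geometric_hahn_banach_point_closed 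
    W.topologicalClosure.convex W.isClosed_topologicalClosure hcon
  -- A linear functional bounded below on a subspace vanishes there: a nonzero value could be
  -- rescaled to `u - 1`.
  have hL0 : ∀ x ∈ W, L x = 0 := by
    intro x hx
    by_contra h0
    have := hLW (((u - 1) / L x) • x) (W.le_topologicalClosure (W.smul_mem _ hx))
    simp [h0] at this
    linarith
  have hzero : (L : (Fin n × Fin 3 → C(K, ℝ)) →ₗ[ℝ] ℝ) ∘ₗ polyJet K = 0 := by
    refine linearMap_eq_zero_of_pow _ fun w m => ?_
    rw [LinearMap.comp_apply, polyJet_pow]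
    exact map_powJet_eq_zero hσ hpoly
      (fun w b => hL0 _ (Submodule.subset_span ⟨(w, b), rfl⟩)) w m
  have h1 : L (polyJet K P) = 0 := LinearMap.congr_fun hzero P
  have h2 := hLW 0 (zero_mem _)
  rw [map_zero] at h2
  linarith

open MvPolynomial in
/-- Networks with a nonpolynomial activation of class `C²` approximate polynomials, together with
their pure derivatives of order at most two, uniformly on compact sets. -/
theorem exists_shallowNet_near {σ : ℝ → ℝ} (hσ : ContDiff ℝ 2 σ)
    (hpoly : ¬ ∃ P : Polynomial ℝ, ∀ s : ℝ, σ s = P.eval s) {K : Set (Fin n → ℝ)}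
    (hK : IsCompact K) (P : MvPolynomial (Fin n) ℝ) {ε : ℝ} (hε : 0 < ε) :
    ∃ N : ShallowNet n, ∀ z ∈ K, ∀ (i : Fin n) (k : ℕ), k ≤ 2 →
      |(∑ l, N.c l * (N.w l i ^ k * iteratedDeriv k σ ((∑ j, N.w l j * z j) + N.b l)))
        - eval z ((pderiv i)^[k] P)| < ε := by
  have : CompactSpace K := isCompact_iff_compactSpace.mp hK
  have hmem := polyJet_mem_closure (K := K) hσ hpoly P
  rw [← SetLike.mem_coe, Submodule.topologicalClosure_coe, Metric.mem_closure_iff] at hmem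
  obtain ⟨x, hx, hdist⟩ := hmem ε hε
  obtain ⟨r, c, g, rfl⟩ := Submodule.mem_span_set'.mp hx
  choose p hp using fun l => (g l).2
  refine ⟨⟨r, fun l => (p l).1, fun l => (p l).2, c⟩, fun z hz i k hk => ?_⟩
  rw [dist_comm, dist_pi_lt_iff hε] at hdist
  have := (ContinuousMap.dist_apply_le_dist ⟨z, hz⟩).trans_lt
    (hdist (i, ⟨k, by omega⟩))
  rw [Real.dist_eq] at this
  simpa [← hp, ridgeJet, ridge, derivMap, polyJet] using this

end NetworkDensity

end VPFP

namespace VPFP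

/-! ### Partial derivatives of networks and the kinetic residual. -/

section Derivatives

/-- The partial derivative of order `k` in the variable `i` of a network. -/
noncomputable def ShallowNet.jet {n : ℕ} (N : ShallowNet n) (σ : ℝ → ℝ) (i : Fin n) (k : ℕ)
    (z : Fin n → ℝ) : ℝ :=
  ∑ l, N.c l * (N.w l i ^ k * iteratedDeriv k σ ((∑ j, N.w l j * z j) + N.b l))

theorem ShallowNet.jet_zero {n : ℕ} (N : ShallowNet n) (σ : ℝ → ℝ) (i : Fin n) (z : Fin n → ℝ) :
    N.jet σ i 0 z = N.eval σ z := by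
  simp [ShallowNet.jet, ShallowNet.eval]

theorem ShallowNet.hasDerivAt_jet {n : ℕ} (N : ShallowNet n) {σ : ℝ → ℝ} (hσ : ContDiff ℝ 2 σ)
    (i : Fin n) {k : ℕ} (hk : k + 1 ≤ 2) (z : Fin n → ℝ) (s : ℝ) :
    HasDerivAt (fun s => N.jet σ i k (Function.update z i s))
      (N.jet σ i (k + 1) (Function.update z i s)) s := by
  refine HasDerivAt.fun_sum fun l _ => HasDerivAt.const_mul _ ?_
  have hin : HasDerivAt (fun s => (∑ j, N.w l j * Function.update z i s j) + N.b l)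
      (N.w l i) s := by
    refine HasDerivAt.add_const _ ?_
    have : HasDerivAt (fun s => ∑ j, N.w l j * Function.update z i s j)
        (∑ j, N.w l j * (Pi.single i (1 : ℝ) : Fin n → ℝ) j) s := by
      refine HasDerivAt.fun_sum fun j _ => HasDerivAt.const_mul _ ?_
      exact hasDerivAt_pi.mp (hasDerivAt_update z i s) j
    simpa [Pi.single_apply] using this
  have hd : DifferentiableAt ℝ (iteratedDeriv k σ)
      ((∑ j, N.w l j * Function.update z i s j) + N.b l) :=
    (hσ.differentiable_iteratedDeriv k (by exact_mod_cast (by omega : k < 2))).differentiableAt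
  have h := (hd.hasDerivAt.comp s hin).const_mul (N.w l i ^ k)
  rw [← iteratedDeriv_succ, mul_comm _ (N.w l i), ← mul_assoc, ← pow_succ] at h
  exact h

theorem ShallowNet.continuous_eval {n : ℕ} (N : ShallowNet n) {σ : ℝ → ℝ} (hσ : Continuous σ) :
    Continuous (N.eval σ) := by
  unfold ShallowNet.eval
  fun_prop

theorem update_zero (t x v s : ℝ) : Function.update ![t, x, v] 0 s = ![s, x, v] := by
  ext i; fin_cases i <;> simp

theorem update_one (t x v s : ℝ) : Function.update ![t, x, v] 1 s = ![t, s, v] := by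
  ext i; fin_cases i <;> simp

theorem update_two (t x v s : ℝ) : Function.update ![t, x, v] 2 s = ![t, x, s] := by
  ext i; fin_cases i <;> simp

theorem update_pair_one (t x s : ℝ) : Function.update ![t, x] 1 s = ![t, s] := by
  ext i; fin_cases i <;> simp

/-- The kinetic residual in terms of the partial derivatives. -/
theorem kineticResidual_eq {f : ℝ → ℝ → ℝ → ℝ} (E : ℝ → ℝ → ℝ) {t x v ft fx fvv : ℝ} {fv : ℝ → ℝ}
    (ht : HasDerivAt (fun s => f s x v) ft t) (hx : HasDerivAt (fun y => f t y v) fx x)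
    (hv : ∀ᶠ u in 𝓝 v, HasDerivAt (f t x) (fv u) u) (hvv : HasDerivAt fv fvv v) :
    kineticResidual f E t x v
      = ft + v * fx + E t x * fv v - (fvv + (f t x v + v * fv v)) := by
  have h1 : deriv (deriv (f t x)) v = fvv := by
    have : deriv (f t x) =ᶠ[𝓝 v] fv := hv.mono fun u hu => hu.deriv
    rw [this.deriv_eq, hvv.deriv]
  have h2 : deriv (fun u => u * f t x u) v = f t x v + v * fv v := by
    have := (hasDerivAt_id' v).fun_mul hv.self_of_nhds
    rw [this.deriv, one_mul]
  rw [kineticResidual, ht.deriv, hx.deriv, hv.self_of_nhds.deriv, h1, h2]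

theorem ShallowNet.kineticResidual_eval (N : ShallowNet 3) {σ : ℝ → ℝ} (hσ : ContDiff ℝ 2 σ)
    (E : ℝ → ℝ → ℝ) (t x v : ℝ) :
    kineticResidual (fun t x v => N.eval σ ![t, x, v]) E t x v
      = N.jet σ 0 1 ![t, x, v] + v * N.jet σ 1 1 ![t, x, v] + E t x * N.jet σ 2 1 ![t, x, v]
        - (N.jet σ 2 2 ![t, x, v] + (N.eval σ ![t, x, v] + v * N.jet σ 2 1 ![t, x, v])) := by
  refine kineticResidual_eq (fv := fun u => N.jet σ 2 1 ![t, x, u]) E ?_ ?_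
    (Eventually.of_forall fun u => ?_) ?_
  · simpa only [N.jet_zero, update_zero] using
      N.hasDerivAt_jet hσ 0 (k := 0) (by norm_num) ![t, x, v] t
  · simpa only [N.jet_zero, update_one] using
      N.hasDerivAt_jet hσ 1 (k := 0) (by norm_num) ![t, x, v] x
  · simpa only [N.jet_zero, update_two] using
      N.hasDerivAt_jet hσ 2 (k := 0) (by norm_num) ![t, x, v] u
  · simpa only [update_two] using
      N.hasDerivAt_jet hσ 2 (k := 1) (by norm_num) ![t, x, v] v

theorem ShallowNet.hasDerivAt_eval_snd (M : ShallowNet 2) {σ : ℝ → ℝ} (hσ : ContDiff ℝ 2 σ)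
    (t x : ℝ) : HasDerivAt (fun y => M.eval σ ![t, y]) (M.jet σ 1 1 ![t, x]) x := by
  simpa only [M.jet_zero, update_pair_one] using
    M.hasDerivAt_jet hσ 1 (k := 0) (by norm_num) ![t, x] x

end Derivatives

/-! ### Network approximation of the distribution `f`. -/

section ApproximationOfDistribution

theorem mem_phaseCylinder {T t x v : ℝ} (ht : t ∈ Icc 0 T) (hx : x ∈ Icc (-1 : ℝ) 1)
    (hv : v ∈ V) : ![t, x, v] ∈ phaseCylinder T := ⟨ht, hx, hv⟩

theorem phaseCylinder_eq_Icc (T : ℝ) : phaseCylinder T = Icc ![0, -1, -10] ![T, 1, 10] := by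
  ext p
  simp only [phaseCylinder, V, mem_ofPred_eq, mem_Icc, Pi.le_def, Fin.forall_fin_succ]
  simp
  tauto

/-- The properties of a function of class `C^(1,1,2)` that the loss estimates use: its derivatives,
bounds for them, and their approximation by networks. -/
theorem exists_derivatives {T : ℝ} {σ : ℝ → ℝ} (hσ : ContDiff ℝ 2 σ)
    (hpoly : ¬ ∃ P : Polynomial ℝ, ∀ s : ℝ, σ s = P.eval s) {f : ℝ → ℝ → ℝ → ℝ}
    (hf : CHat ![1, 1, 2] (phaseCylinder T) (fun p => f (p 0) (p 1) (p 2))) :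
    ∃ ft fx fv fvv : ℝ → ℝ → ℝ → ℝ, ∃ C : ℝ,
      (∀ t ∈ Icc 0 T, ∀ x ∈ Icc (-1 : ℝ) 1, ∀ v ∈ V, |f t x v| ≤ C ∧ |fv t x v| ≤ C ∧
        ∀ E, kineticResidual f E t x v = ft t x v + v * fx t x v + E t x * fv t x v
          - (fvv t x v + (f t x v + v * fv t x v))) ∧
      ∀ ε > 0, ∃ N : ShallowNet 3, ∀ t ∈ Icc 0 T, ∀ x ∈ Icc (-1 : ℝ) 1, ∀ v ∈ V,
        |N.eval σ ![t, x, v] - f t x v| < ε ∧ |N.jet σ 0 1 ![t, x, v] - ft t x v| < ε ∧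
        |N.jet σ 1 1 ![t, x, v] - fx t x v| < ε ∧ |N.jet σ 2 1 ![t, x, v] - fv t x v| < ε ∧
        |N.jet σ 2 2 ![t, x, v] - fvv t x v| < ε := by
  obtain ⟨Ω, hΩ, hKΩ, D, hD0, hDc, hD⟩ := hf
  have hle : ∀ k : Fin 3 → ℕ, k 0 ≤ 1 → k 1 ≤ 1 → k 2 ≤ 2 → k ≤ ![1, 1, 2] := by
    intro k h0 h1 h2 i
    fin_cases i <;> assumption
  have hK : IsCompact (phaseCylinder T) := by
    rw [phaseCylinder_eq_Icc]; exact isCompact_Icc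
  have hDcK : ∀ k ≤ ![1, 1, 2], ContinuousOn (D k) (phaseCylinder T) :=
    fun k hk => (hDc k hk).mono hKΩ
  have hline : ∀ (k : Fin 3 → ℕ) (i : Fin 3), k + Pi.single i 1 ≤ ![1, 1, 2] →
      ∀ (p : Fin 3 → ℝ) (s : ℝ), Function.update p i s ∈ Ω →
      HasDerivAt (fun s => D k (Function.update p i s))
        (D (k + Pi.single i 1) (Function.update p i s)) s := by
    intro k i hk p s hs
    simpa using hD k i hk _ hs
  obtain ⟨C₀, hC₀⟩ := hK.exists_bound_of_continuousOn
    (hDcK 0 (hle _ (by simp) (by simp) (by simp)))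
  obtain ⟨C₁, hC₁⟩ := hK.exists_bound_of_continuousOn
    (hDcK (0 + Pi.single 2 1) (hle _ (by simp) (by simp) (by simp)))
  refine ⟨fun t x v => D (0 + Pi.single 0 1) ![t, x, v],
    fun t x v => D (0 + Pi.single 1 1) ![t, x, v],
    fun t x v => D (0 + Pi.single 2 1) ![t, x, v],
    fun t x v => D (0 + Pi.single 2 1 + Pi.single 2 1) ![t, x, v], max C₀ C₁, ?_, ?_⟩
  · intro t ht x hx v hv
    have hmem := mem_phaseCylinder ht hx hv
    refine ⟨?_, (hC₁ _ hmem).trans (le_max_right _ _), fun E => ?_⟩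
    · have := hD0 _ (hKΩ hmem)
      simp only [Matrix.cons_val] at this
      rw [← this]
      exact (hC₀ _ hmem).trans (le_max_left _ _)
    -- Since `Ω` is an open neighbourhood of the cylinder, `f` agrees with `D 0` on both sides of
    -- each point along coordinate lines, so `deriv` gives the expected values even on the boundary.
    have hnear : ∀ (i : Fin 3), ∀ᶠ s in 𝓝 (![t, x, v] i), Function.update ![t, x, v] i s ∈ Ω := by
      intro i
      have hc : Continuous fun s : ℝ => Function.update ![t, x, v] i s :=
        (continuous_const (y := ![t, x, v])).update i continuous_id
      refine hc.continuousAt.eventually_mem (hΩ.mem_nhds ?_)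
      simpa using hKΩ hmem
    have heq : ∀ i : Fin 3, (fun s => D 0 (Function.update ![t, x, v] i s)) =ᶠ[𝓝 (![t, x, v] i)]
        fun s => f (Function.update ![t, x, v] i s 0) (Function.update ![t, x, v] i s 1)
          (Function.update ![t, x, v] i s 2) :=
      fun i => (hnear i).mono fun s hs => hD0 _ hs
    refine kineticResidual_eq (fv := fun u => D (0 + Pi.single 2 1) ![t, x, u]) E ?_ ?_ ?_ ?_
    · have h := hline 0 0 (hle _ (by simp) (by simp) (by simp)) ![t, x, v] t
        (by rw [update_zero]; exact hKΩ hmem)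
      have h' := h.congr_of_eventuallyEq (heq 0).symm
      simpa only [update_zero, Matrix.cons_val] using h'
    · have h := hline 0 1 (hle _ (by simp) (by simp) (by simp)) ![t, x, v] x
        (by rw [update_one]; exact hKΩ hmem)
      have h' := h.congr_of_eventuallyEq (heq 1).symm
      simpa only [update_one, Matrix.cons_val] using h'
    · have h2 := (hnear 2).eventually_nhds
      have h3 := (heq 2).eventually_nhds
      filter_upwards [h2, h3] with u hu hu'
      have h := hline 0 2 (hle _ (by simp) (by simp) (by simp)) ![t, x, v] u hu.self_of_nhds
      have h' := h.congr_of_eventuallyEq (EventuallyEq.symm hu')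
      simpa only [update_two, Matrix.cons_val] using h'
    · have h := hline (0 + Pi.single 2 1) 2 (hle _ (by simp) (by simp) (by simp)) ![t, x, v] v
        (by rw [update_two]; exact hKΩ hmem)
      simpa only [update_two] using h
  · intro ε hε
    obtain ⟨Q, hQ, hQD⟩ := exists_mvPolynomial_near_deriv (a := ![0, -1, -10]) (b := ![T, 1, 10])
      ![1, 1, 2] D (by rw [← phaseCylinder_eq_Icc]; exact hDcK)
      (fun k i hk p hp => by
        have hsub : ∀ s ∈ uIcc (![0, -1, -10] i) (p i),
            Function.update p i s ∈ phaseCylinder T := by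
          intro s hs
          rw [phaseCylinder_eq_Icc]
          rw [uIcc_of_le (hp.1 i)] at hs
          exact update_mem_Icc hp ⟨hs.1, hs.2.trans (hp.2 i)⟩
        have hc : ContinuousOn (fun s => D (k + Pi.single i 1) (Function.update p i s))
            (uIcc (![0, -1, -10] i) (p i)) :=
          (hDcK _ hk).comp ((continuous_const (y := p)).update i continuous_id).continuousOn hsub
        rw [intervalIntegral.integral_eq_sub_of_hasDerivAt
          (fun s hs => hline k i hk p s (hKΩ (hsub s hs))) hc.intervalIntegrable]
        simp)
      (half_pos hε)
    obtain ⟨N, hN⟩ := exists_shallowNet_near hσ hpoly hK (Q 0) (half_pos hε)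
    refine ⟨N, fun t ht x hx v hv => ?_⟩
    have hmem := mem_phaseCylinder ht hx hv
    -- The residual contains only pure derivatives, so the jets approximated by networks suffice;
    -- half of `ε` goes to each of the two approximations.
    have hclose : ∀ (i : Fin 3) (k : ℕ) (hk : k ≤ 2) (m : Fin 3 → ℕ), m ≤ ![1, 1, 2] →
        (MvPolynomial.pderiv i)^[k] (Q 0) = Q m → |N.jet σ i k ![t, x, v] - D m ![t, x, v]| < ε := by
      intro i k hk m hm hQm
      have h1 := hN _ hmem i k hk
      rw [hQm] at h1
      have h2 := hQD m hm ![t, x, v] (by rw [← phaseCylinder_eq_Icc]; exact hmem)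
      rw [ShallowNet.jet]
      refine (abs_sub_le _ _ _).trans_lt ((add_lt_add h1 h2).trans_eq (add_halves ε))
    have hQ2 : (0 + Pi.single 2 1 : Fin 3 → ℕ) ≤ ![1, 1, 2] :=
      hle _ (by simp) (by simp) (by simp)
    have hQ22 : (0 + Pi.single 2 1 + Pi.single 2 1 : Fin 3 → ℕ) ≤ ![1, 1, 2] :=
      hle _ (by simp) (by simp) (by simp)
    refine ⟨?_, ?_, ?_, ?_, ?_⟩
    · have h := hclose 0 0 (by norm_num) 0 (hle _ (by simp) (by simp) (by simp)) rfl
      have h0 := hD0 _ (hKΩ hmem)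
      simp only [Matrix.cons_val] at h0
      rwa [N.jet_zero, h0] at h
    · exact hclose 0 1 (by norm_num) _ (hle _ (by simp) (by simp) (by simp))
        (hQ 0 0 (hle _ (by simp) (by simp) (by simp))).symm
    · exact hclose 1 1 (by norm_num) _ (hle _ (by simp) (by simp) (by simp))
        (hQ 0 1 (hle _ (by simp) (by simp) (by simp))).symm
    · exact hclose 2 1 (by norm_num) _ hQ2 (hQ 0 2 hQ2).symm
    · exact hclose 2 2 le_rfl _ hQ22 (by rw [hQ _ 2 hQ22, hQ 0 2 hQ2]; rfl)

end ApproximationOfDistribution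

/-! ### Network approximation of the field `E`. -/

section ApproximationOfField

/-- A function of `(t, x)` that vanishes at `x = -1` and whose `x`-derivative `g` is continuous is
approximated by networks together with this derivative. -/
theorem exists_shallowNet_near_primitive {T : ℝ} {σ : ℝ → ℝ} (hσ : ContDiff ℝ 2 σ)
    (hpoly : ¬ ∃ P : Polynomial ℝ, ∀ s : ℝ, σ s = P.eval s) {g E : ℝ → ℝ → ℝ}
    (hg : ContinuousOn (fun p : ℝ × ℝ => g p.1 p.2) (Icc 0 T ×ˢ Icc (-1) 1))
    (hE : ∀ t ∈ Icc 0 T, ∀ x ∈ Icc (-1 : ℝ) 1, E t x = ∫ y in (-1)..x, g t y)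
    {ε : ℝ} (hε : 0 < ε) :
    ∃ M : ShallowNet 2, ∀ t ∈ Icc 0 T, ∀ x ∈ Icc (-1 : ℝ) 1,
      |M.eval σ ![t, x] - E t x| < ε ∧ |M.jet σ 1 1 ![t, x] - g t x| < ε := by
  have hmem : ∀ {p : Fin 2 → ℝ}, p ∈ Icc ![0, -1] ![T, 1] ↔
      p 0 ∈ Icc 0 T ∧ p 1 ∈ Icc (-1 : ℝ) 1 := by
    intro p
    simp only [mem_Icc, Pi.le_def, Fin.forall_fin_two]
    simp
    tauto
  have hgK : ContinuousOn (fun p : Fin 2 → ℝ => g (p 0) (p 1)) (Icc ![0, -1] ![T, 1]) :=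
    hg.comp (f := fun p : Fin 2 → ℝ => (p 0, p 1))
      ((continuous_apply 0).prodMk (continuous_apply 1)).continuousOn fun p hp => hmem.mp hp
  -- Integrating `q` from `-1` approximates `E` and `∂ₓE` at once. The interval has length `2`, so
  -- the error for `E` is at most `2 * (ε / 4)` plus `ε / 4` from the network.
  obtain ⟨q, hq⟩ := exists_mvPolynomial_near isCompact_Icc hgK (by positivity : 0 < ε / 4)
  obtain ⟨M, hM⟩ := exists_shallowNet_near hσ hpoly
    (isCompact_Icc (a := ![0, -1]) (b := ![T, 1])) (antiderivFrom 1 (-1) q)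
    (by positivity : 0 < ε / 4)
  refine ⟨M, fun t ht x hx => ?_⟩
  have hp : ![t, x] ∈ Icc ![0, -1] ![T, 1] := hmem.mpr ⟨ht, hx⟩
  have h0 := hM _ hp 1 0 (by norm_num)
  have h1 := hM _ hp 1 1 (by norm_num)
  rw [← ShallowNet.jet] at h0 h1
  rw [M.jet_zero, Function.iterate_zero, id, eval_antiderivFrom] at h0
  rw [Function.iterate_one, pderiv_antiderivFrom_self] at h1
  have hq' := hq _ hp
  simp only [Matrix.cons_val, update_pair_one] at h0 hq'
  refine ⟨?_, ?_⟩
  · have hsub : uIcc (-1) x ⊆ Icc (-1 : ℝ) 1 := by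
      rw [uIcc_of_le hx.1]; exact Icc_subset_Icc_right hx.2
    have hint : IntervalIntegrable (g t) volume (-1) x := by
      refine ContinuousOn.intervalIntegrable ?_
      exact hg.comp (by fun_prop : Continuous fun y : ℝ => (t, y)).continuousOn
        fun y hy => ⟨ht, hsub hy⟩
    have hint' : IntervalIntegrable (fun y => MvPolynomial.eval ![t, y] q) volume (-1) x := by
      have := (continuous_eval_update q 1 ![t, x]).intervalIntegrable (μ := volume) (-1) x
      simpa only [update_pair_one] using this
    have h2 : ‖∫ y in (-1)..x, (MvPolynomial.eval ![t, y] q - g t y)‖ ≤ ε / 4 * |x - (-1)| := by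
      refine intervalIntegral.norm_integral_le_of_norm_le_const fun y hy => ?_
      have := hq ![t, y] (hmem.mpr ⟨ht, hsub (uIoc_subset_uIcc hy)⟩)
      simp only [Matrix.cons_val] at this
      exact this.le
    rw [intervalIntegral.integral_sub hint' hint, ← hE t ht x hx, Real.norm_eq_abs,
      abs_of_nonneg (by linarith [hx.1] : 0 ≤ x - (-1))] at h2
    refine (abs_sub_le _ _ _).trans_lt (add_lt_add_of_lt_of_le h0 h2 |>.trans_le ?_)
    nlinarith [hx.2]
  · refine (abs_sub_le _ _ _).trans_lt ((add_lt_add h1 hq').trans ?_)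
    linarith

end ApproximationOfField

end VPFP

namespace VPFP

/-! ### From uniform bounds on residuals to bounds on the losses. -/

section LossEstimates

theorem setLIntegral_le_const {s : Set ℝ} (hs : MeasurableSet s) {F : ℝ → ℝ≥0∞} {c : ℝ≥0∞}
    (h : ∀ x ∈ s, F x ≤ c) : ∫⁻ x in s, F x ≤ c * volume s :=
  (setLIntegral_mono' hs h).trans_eq (setLIntegral_const s c)

theorem enorm_sq_le {r η : ℝ} (h : |r| ≤ η) : ‖r‖ₑ ^ 2 ≤ ENNReal.ofReal (η ^ 2) := by
  rw [Real.enorm_eq_ofReal_abs, ← ENNReal.ofReal_pow (abs_nonneg r)]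
  exact ENNReal.ofReal_le_ofReal (pow_le_pow_left₀ (abs_nonneg r) h 2)

theorem enorm_sq_le_add {r s S η : ℝ} (hs : |s| ≤ S) (h : |r - s| ≤ η) :
    ‖r‖ₑ ^ 2 ≤ ‖s‖ₑ ^ 2 + ENNReal.ofReal (η * (2 * S + η)) := by
  have hη : 0 ≤ η := (abs_nonneg _).trans h
  have hS : 0 ≤ S := (abs_nonneg _).trans hs
  rw [Real.enorm_eq_ofReal_abs, Real.enorm_eq_ofReal_abs, ← ENNReal.ofReal_pow (abs_nonneg r),
    ← ENNReal.ofReal_pow (abs_nonneg s), ← ENNReal.ofReal_add (by positivity) (by positivity)]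
  refine ENNReal.ofReal_le_ofReal ?_
  have h1 : |r| ≤ |s| + η := by
    have := abs_sub_abs_le_abs_sub r s
    linarith
  have h2 : |r| ^ 2 ≤ (|s| + η) ^ 2 := pow_le_pow_left₀ (abs_nonneg r) h1 2
  nlinarith [mul_le_mul_of_nonneg_left hs hη]

/-- The kinetic equation is known only for interior velocities; the two endpoints of `V` form a null
set. -/
theorem lossGE1_le {T η : ℝ} {f : ℝ → ℝ → ℝ → ℝ} {E : ℝ → ℝ → ℝ}
    (h : ∀ t ∈ Ioo 0 T, ∀ x ∈ Ioo (-1 : ℝ) 1, ∀ v ∈ interior V, |kineticResidual f E t x v| ≤ η) :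
    lossGE1 T f E ≤ ENNReal.ofReal (η ^ 2)
      * (volume (Ioo (-10 : ℝ) 10) * volume (Ioo (-1 : ℝ) 1) * volume (Ioo 0 T)) := by
  rw [← mul_assoc, ← mul_assoc]
  refine setLIntegral_le_const measurableSet_Ioo fun t ht =>
    setLIntegral_le_const measurableSet_Ioo fun x hx => ?_
  rw [V, ← setLIntegral_congr Ioo_ae_eq_Icc]
  refine setLIntegral_le_const measurableSet_Ioo fun v hv => enorm_sq_le (h t ht x hx v ?_)
  rwa [V, interior_Icc]

/-- The term split off is a constant, so neither `F` nor `G` has to be measurable. -/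
theorem lintegral_lintegral_le_add {T : ℝ} {F G : ℝ → ℝ → ℝ≥0∞} {c : ℝ≥0∞}
    (h : ∀ t ∈ Ioo 0 T, ∀ x ∈ Ioo (-1 : ℝ) 1, F t x ≤ G t x + c) :
    ∫⁻ t in Ioo 0 T, ∫⁻ x in Ioo (-1) 1, F t x ≤ (∫⁻ t in Ioo 0 T, ∫⁻ x in Ioo (-1) 1, G t x)
      + c * (volume (Ioo (-1 : ℝ) 1) * volume (Ioo 0 T)) := by
  have h1 : ∀ t ∈ Ioo 0 T, ∫⁻ x in Ioo (-1) 1, F t x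
      ≤ (∫⁻ x in Ioo (-1) 1, G t x) + c * volume (Ioo (-1 : ℝ) 1) := fun t ht => by
    refine (setLIntegral_mono' measurableSet_Ioo (h t ht)).trans_eq ?_
    rw [lintegral_add_right _ measurable_const, setLIntegral_const]
  refine (setLIntegral_mono' measurableSet_Ioo h1).trans_eq ?_
  rw [lintegral_add_right _ measurable_const, setLIntegral_const, mul_assoc]

theorem lossIC1_le {η : ℝ} {f₀ : ℝ → ℝ → ℝ} {f : ℝ → ℝ → ℝ → ℝ}
    (h : ∀ x ∈ Ioo (-1 : ℝ) 1, ∀ v ∈ V, |f 0 x v - f₀ x v| ≤ η) :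
    lossIC1 f₀ f ≤ ENNReal.ofReal (η ^ 2) * (volume V * volume (Ioo (-1 : ℝ) 1)) := by
  rw [← mul_assoc]
  exact setLIntegral_le_const measurableSet_Ioo fun x hx =>
    setLIntegral_le_const measurableSet_Icc fun v hv => enorm_sq_le (h x hx v hv)

theorem lossIC2_le {D : Set ℝ} {η : ℝ} {h : ℝ → ℝ} {f₀ : ℝ → ℝ → ℝ} {E : ℝ → ℝ → ℝ}
    (hE : ∀ x ∈ Ioo (-1 : ℝ) 1,
      |E 0 x - ((∫ y in (-1)..x, ∫ v in D, f₀ y v) - ∫ y in (-1)..x, h y)| ≤ η) :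
    lossIC2 D h f₀ E ≤ ENNReal.ofReal (η ^ 2) * volume (Ioo (-1 : ℝ) 1) :=
  setLIntegral_le_const measurableSet_Ioo fun x hx => enorm_sq_le (hE x hx)

theorem lossBC1_le {T η : ℝ} {f : ℝ → ℝ → ℝ → ℝ}
    (h : ∀ t ∈ Ioo 0 T, ∀ x ∈ ({-1, 1} : Set ℝ), ∀ v ∈ V, x * v < 0 →
      |f t x v - f t x (-v)| ≤ η) :
    lossBC1 T f ≤ ENNReal.ofReal (η ^ 2) * (2 * volume V * volume (Ioo 0 T)) := by
  rw [← mul_assoc]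
  refine setLIntegral_le_const measurableSet_Ioo fun t ht => ?_
  have hx : ∀ x ∈ ({-1, 1} : Finset ℝ), ∫⁻ v in {v ∈ V | x * v < 0}, ‖f t x v - f t x (-v)‖ₑ ^ 2
      ≤ ENNReal.ofReal (η ^ 2) * volume V := by
    intro x hx
    have hms : MeasurableSet {v ∈ V | x * v < 0} :=
      measurableSet_Icc.inter
        (measurableSet_lt (measurable_id.const_mul x) measurable_const)
    refine (setLIntegral_le_const hms fun v hv =>
      enorm_sq_le (h t ht x (by simpa using hx) v hv.1 hv.2)).trans ?_
    gcongr
    exact sep_subset _ _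
  refine (Finset.sum_le_card_nsmul _ _ _ hx).trans_eq ?_
  rw [Finset.card_pair (by norm_num), nsmul_eq_mul, Nat.cast_ofNat]
  ring

theorem lossBC2_le {T η : ℝ} {E : ℝ → ℝ → ℝ}
    (h : ∀ t ∈ Ioo 0 T, ∀ x ∈ ({-1, 1} : Set ℝ), |E t x| ≤ η) :
    lossBC2 T E ≤ ENNReal.ofReal (η ^ 2) * (2 * volume (Ioo 0 T)) := by
  rw [← mul_assoc]
  refine setLIntegral_le_const measurableSet_Ioo fun t ht => ?_
  refine (Finset.sum_le_card_nsmul _ _ _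
    fun x hx => enorm_sq_le (h t ht x (by simpa using hx))).trans_eq ?_
  rw [Finset.card_pair (by norm_num), nsmul_eq_mul, Nat.cast_ofNat]
  ring

theorem tendsto_zero_of_le_ofReal_mul {u : ℕ → ℝ≥0∞} {η : ℕ → ℝ} {c : ℝ≥0∞} (hc : c ≠ ∞)
    (hη : Tendsto η atTop (𝓝 0)) (h : ∀ j, u j ≤ ENNReal.ofReal (η j) * c) :
    Tendsto u atTop (𝓝 0) := by
  refine tendsto_of_tendsto_of_tendsto_of_le_of_le tendsto_const_nhds ?_ (fun _ => zero_le) h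
  have := ENNReal.Tendsto.mul_const (b := c) (ENNReal.tendsto_ofReal hη) (Or.inr hc)
  simpa using this

theorem tendsto_of_le_add_of_le_add {u c : ℕ → ℝ≥0∞} {a : ℝ≥0∞} (ha : a ≠ ∞)
    (hc : Tendsto c atTop (𝓝 0)) (h1 : ∀ j, u j ≤ a + c j) (h2 : ∀ j, a ≤ u j + c j) :
    Tendsto u atTop (𝓝 a) := by
  refine tendsto_of_tendsto_of_tendsto_of_le_of_le (g := fun j => a - c j)
    (h := fun j => a + c j) ?_ ?_ (fun j => tsub_le_iff_right.mpr (h2 j)) h1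
  · simpa using ENNReal.Tendsto.sub (tendsto_const_nhds (x := a)) hc (Or.inl ha)
  · simpa using tendsto_const_nhds.add hc

end LossEstimates

/-! ### Convergence of each loss and of their sum. -/

section Convergence

/-- The field of a solution is the primitive of the net charge density. -/
theorem IsSolution.field_eq {D : Set ℝ} {T : ℝ} {h : ℝ → ℝ} {f₀ : ℝ → ℝ → ℝ}
    {f : ℝ → ℝ → ℝ → ℝ} {E : ℝ → ℝ → ℝ} (hh : ContinuousOn h (Icc (-1) 1))
    (hS : IsSolution D T h f₀ f E) {t : ℝ} (ht : t ∈ Icc 0 T) {x : ℝ} (hx : x ∈ Icc (-1 : ℝ) 1) :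
    E t x = (∫ y in (-1)..x, ∫ v in D, f t y v) - ∫ y in (-1)..x, h y := by
  have hsub : Icc (-1) x ⊆ Icc (-1 : ℝ) 1 := Icc_subset_Icc_right hx.2
  have hρ : IntervalIntegrable (fun y => ∫ v in D, f t y v) volume (-1) x := by
    refine ContinuousOn.intervalIntegrable ?_
    rw [uIcc_of_le hx.1]
    exact hS.continuous_density.comp (by fun_prop : Continuous fun y : ℝ => (t, y)).continuousOn
      fun y hy => ⟨ht, hsub hy⟩
  have hhi : IntervalIntegrable h volume (-1) x := by
    refine ContinuousOn.intervalIntegrable ?_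
    rw [uIcc_of_le hx.1]
    exact hh.mono hsub
  have h1 := intervalIntegral.integral_eq_sub_of_hasDerivAt_of_le hx.1
    ((hS.continuous_field t ht).mono hsub)
    (fun y hy => hS.poisson t ht y ⟨hy.1, hy.2.trans_le hx.2⟩) (hρ.sub hhi)
  rw [intervalIntegral.integral_sub hρ hhi, hS.dirichlet t ht (-1) (by simp), sub_zero] at h1
  exact h1.symm

/-- Networks whose total loss tends to the error of the velocity truncation, for every velocity
domain that contains `V`. -/
theorem exists_tendsto_lossTotal {T : ℝ} (hT : 0 < T) {σ : ℝ → ℝ} (hσ : ContDiff ℝ 2 σ)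
    (hpoly : ¬ ∃ P : Polynomial ℝ, ∀ s : ℝ, σ s = P.eval s) {h : ℝ → ℝ}
    (hh : ContinuousOn h (Icc (-1) 1)) {f₀ : ℝ → ℝ → ℝ} {f : ℝ → ℝ → ℝ → ℝ} {E : ℝ → ℝ → ℝ}
    (hf : CHat ![1, 1, 2] (phaseCylinder T) (fun p => f (p 0) (p 1) (p 2)))
    {D : Set ℝ} (hD : MeasurableSet D) (hVD : V ⊆ D) (hS : IsSolution D T h f₀ f E) :
    ∃ (N : ℕ → ShallowNet 3) (M : ℕ → ShallowNet 2),
      Tendsto (fun j => lossTotal D T h f₀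
          (fun t x v => (N j).eval σ ![t, x, v]) (fun t x => (M j).eval σ ![t, x])) atTop
        (𝓝 (∫⁻ t in Ioo 0 T, ∫⁻ x in Ioo (-1) 1, ‖∫ v in D \ V, f t x v‖ₑ ^ 2)) := by
  obtain ⟨ft, fx, fv, fvv, C, hC, hN⟩ := exists_derivatives hσ hpoly hf
  set ρ : ℝ → ℝ → ℝ := fun t x => ∫ v in D, f t x v with hρ
  have hg : ContinuousOn (fun p : ℝ × ℝ => ρ p.1 p.2 - h p.2) (Icc 0 T ×ˢ Icc (-1) 1) :=
    hS.continuous_density.sub (hh.comp continuous_snd.continuousOn fun p hp => hp.2)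
  have hcpt : IsCompact (Icc 0 T ×ˢ Icc (-1 : ℝ) 1) := isCompact_Icc.prod isCompact_Icc
  have hE : ∀ t ∈ Icc 0 T, ∀ x ∈ Icc (-1 : ℝ) 1, E t x = ∫ y in (-1)..x, (ρ t y - h y) := by
    intro t ht x hx
    have hsub : uIcc (-1) x ⊆ Icc (-1 : ℝ) 1 := by
      rw [uIcc_of_le hx.1]; exact Icc_subset_Icc_right hx.2
    rw [hS.field_eq hh ht hx, intervalIntegral.integral_sub]
    · exact ContinuousOn.intervalIntegrable (hS.continuous_density.comp
        (by fun_prop : Continuous fun y : ℝ => (t, y)).continuousOn fun y hy => ⟨ht, hsub hy⟩)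
    · exact (hh.mono hsub).intervalIntegrable
  obtain ⟨R, hR⟩ := hcpt.exists_bound_of_continuousOn hS.continuous_density
  obtain ⟨G, hG⟩ := hcpt.exists_bound_of_continuousOn hg
  have hR' : ∀ t ∈ Icc 0 T, ∀ x ∈ Icc (-1 : ℝ) 1, |ρ t x| ≤ R := fun t ht x hx => hR (t, x) ⟨ht, hx⟩
  have hEb : ∀ t ∈ Icc 0 T, ∀ x ∈ Icc (-1 : ℝ) 1, |E t x| ≤ 2 * G := by
    intro t ht x hx
    have h1 : ‖∫ y in (-1)..x, (ρ t y - h y)‖ ≤ G * |x - (-1)| := by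
      refine intervalIntegral.norm_integral_le_of_norm_le_const fun y hy => hG (t, y) ⟨ht, ?_⟩
      rw [uIoc_of_le hx.1] at hy
      exact ⟨hy.1.le, hy.2.trans hx.2⟩
    have hG0 : 0 ≤ G := (norm_nonneg _).trans (hG (t, x) ⟨ht, hx⟩)
    rw [← hE t ht x hx, Real.norm_eq_abs, abs_of_nonneg (by linarith [hx.1] : 0 ≤ x - (-1))] at h1
    nlinarith [hx.2]
  have hmem : ((0 : ℝ) ∈ Icc 0 T) ∧ ((0 : ℝ) ∈ Icc (-1 : ℝ) 1) ∧ ((0 : ℝ) ∈ V) := by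
    simp [V, hT.le]
  have hC0 : 0 ≤ C := (abs_nonneg _).trans (hC 0 hmem.1 0 hmem.2.1 0 hmem.2.2).1
  have hG0 : 0 ≤ G := (norm_nonneg _).trans (hG (0, 0) ⟨hmem.1, hmem.2.1⟩)
  obtain ⟨ε, hεpos, hε1, hε0⟩ : ∃ ε : ℕ → ℝ, (∀ j, 0 < ε j) ∧ (∀ j, ε j ≤ 1) ∧
      Tendsto ε atTop (𝓝 0) :=
    ⟨fun j => 1 / ((j : ℝ) + 1), fun j => by positivity, fun j => by
      rw [div_le_one (by positivity)]; linarith [(Nat.cast_nonneg j : (0 : ℝ) ≤ j)],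
      tendsto_one_div_add_atTop_nhds_zero_nat⟩
  choose N hN using fun j : ℕ => hN _ (hεpos j)
  choose M hM using fun j : ℕ => exists_shallowNet_near_primitive hσ hpoly hg hE (hεpos j)
  refine ⟨N, M, ?_⟩
  have hIoo : ∀ {t}, t ∈ Ioo 0 T → t ∈ Icc 0 T := fun ht => Ioo_subset_Icc_self ht
  have hIoo' : ∀ {x : ℝ}, x ∈ Ioo (-1 : ℝ) 1 → x ∈ Icc (-1 : ℝ) 1 := fun hx => Ioo_subset_Icc_self hx
  have hend : ∀ {x : ℝ}, x ∈ ({-1, 1} : Set ℝ) → x ∈ Icc (-1 : ℝ) 1 := by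
    rintro x (rfl | rfl) <;> simp
  have hfin : ∀ a b : ℝ, volume (Ioo a b) ≠ ∞ := fun a b => by simp
  have hfinV : volume V ≠ ∞ := by simp [V]
  have hpow : ∀ c : ℝ, Tendsto (fun j => (c * ε j) ^ 2) atTop (𝓝 0) := fun c => by
    simpa using (hε0.const_mul c).pow 2
  have hGE1 : Tendsto (fun j => lossGE1 T (fun t x v => (N j).eval σ ![t, x, v])
      (fun t x => (M j).eval σ ![t, x])) atTop (𝓝 0) := by
    -- The factor of `ε j` counts the terms of `hid`: `1` each for `∂ₜf`, `∂ᵥᵥf`, `f` and the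
    -- product of two errors, `10` each for `v ∂ₓf` and `v ∂ᵥf`, and `C + 2 * G` for the cross terms
    -- of `E ∂ᵥf`.
    refine tendsto_zero_of_le_ofReal_mul (ENNReal.mul_ne_top (ENNReal.mul_ne_top (hfin (-10) 10)
      (hfin (-1) 1)) (hfin 0 T)) (hpow (24 + C + 2 * G))
      fun j => lossGE1_le fun t ht x hx v hv => ?_
    have hvV : v ∈ V := interior_subset hv
    obtain ⟨n0, n1, n2, n3, n4⟩ := hN j t (hIoo ht) x (hIoo' hx) v hvV
    obtain ⟨e0, -⟩ := hM j t (hIoo ht) x (hIoo' hx)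
    obtain ⟨-, c1, hres⟩ := hC t (hIoo ht) x (hIoo' hx) v hvV
    have hEt := hEb t (hIoo ht) x (hIoo' hx)
    have hzero := hS.kinetic t ht x hx v (interior_mono hVD hv)
    rw [hres] at hzero
    rw [(N j).kineticResidual_eval hσ]
    have hv10 : |v| ≤ 10 := abs_le.mpr hvV
    generalize (N j).jet σ 0 1 ![t, x, v] = a1 at *
    generalize (N j).jet σ 1 1 ![t, x, v] = a2 at *
    generalize (N j).jet σ 2 1 ![t, x, v] = a3 at *
    generalize (N j).jet σ 2 2 ![t, x, v] = a4 at *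
    generalize (N j).eval σ ![t, x, v] = a0 at *
    generalize (M j).eval σ ![t, x] = e at *
    -- Subtracting the vanishing residual of the exact solution leaves only errors; the one
    -- nonlinear term `E ∂ᵥf` is expanded around the solution, and `ε j ≤ 1` makes its quadratic
    -- error linear.
    have hid : a1 + v * a2 + e * a3 - (a4 + (a0 + v * a3))
        = (a1 - ft t x v) + v * (a2 - fx t x v) + ((e - E t x) * (a3 - fv t x v)
          + (e - E t x) * fv t x v + E t x * (a3 - fv t x v)) - (a4 - fvv t x v)
          - (a0 - f t x v) - v * (a3 - fv t x v) := by linear_combination hzero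
    have p1 : |v * (a2 - fx t x v)| ≤ 10 * ε j := by
      rw [abs_mul]; gcongr
    have p2 : |v * (a3 - fv t x v)| ≤ 10 * ε j := by
      rw [abs_mul]; gcongr
    have p3 : |(e - E t x) * (a3 - fv t x v)| ≤ ε j * 1 := by
      rw [abs_mul]
      exact mul_le_mul e0.le (n3.le.trans (hε1 j)) (abs_nonneg _) (hεpos j).le
    have p4 : |(e - E t x) * fv t x v| ≤ ε j * C := by
      rw [abs_mul]
      exact mul_le_mul e0.le c1 (abs_nonneg _) (hεpos j).le
    have p5 : |E t x * (a3 - fv t x v)| ≤ 2 * G * ε j := by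
      rw [abs_mul]
      exact mul_le_mul hEt n3.le (abs_nonneg _) (by positivity)
    rw [hid]
    rw [abs_lt] at n0 n1 n4
    rw [abs_le] at p1 p2 p3 p4 p5 ⊢
    constructor <;> nlinarith
  have hIC1 : Tendsto (fun j => lossIC1 f₀ (fun t x v => (N j).eval σ ![t, x, v]))
      atTop (𝓝 0) := by
    refine tendsto_zero_of_le_ofReal_mul (ENNReal.mul_ne_top hfinV (hfin (-1) 1)) (hpow 1)
      fun j => lossIC1_le fun x hx v hv => ?_
    rw [← hS.initial x hx v (hVD hv), one_mul]
    exact (hN j 0 hmem.1 x (hIoo' hx) v hv).1.le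
  have hIC2 : Tendsto (fun j => lossIC2 D h f₀ (fun t x => (M j).eval σ ![t, x]))
      atTop (𝓝 0) := by
    refine tendsto_zero_of_le_ofReal_mul (hfin (-1) 1) (hpow 1) fun j => lossIC2_le fun x hx => ?_
    have hinit : ∫ y in (-1)..x, ∫ v in D, f₀ y v = ∫ y in (-1)..x, ∫ v in D, f 0 y v := by
      refine intervalIntegral.integral_congr_ae (Eventually.of_forall fun y hy => ?_)
      rw [uIoc_of_le hx.1.le] at hy
      exact (setIntegral_congr_fun hD fun v hv =>
        hS.initial y ⟨hy.1, hy.2.trans_lt hx.2⟩ v hv).symm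
    rw [hinit, ← hS.field_eq hh hmem.1 (hIoo' hx), one_mul]
    exact (hM j 0 hmem.1 x (hIoo' hx)).1.le
  have hBC1 : Tendsto (fun j => lossBC1 T (fun t x v => (N j).eval σ ![t, x, v]))
      atTop (𝓝 0) := by
    refine tendsto_zero_of_le_ofReal_mul (ENNReal.mul_ne_top (ENNReal.mul_ne_top (by simp) hfinV)
      (hfin 0 T)) (hpow 2) fun j => lossBC1_le fun t ht x hx v hv hxv => ?_
    have hv' : -v ∈ V := ⟨by linarith [hv.2], by linarith [hv.1]⟩
    have h1 := (hN j t (hIoo ht) x (hend hx) v hv).1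
    have h2 := (hN j t (hIoo ht) x (hend hx) (-v) hv').1
    rw [hS.specular t (hIoo ht) x hx v (hVD hv) hxv] at h1
    rw [abs_lt] at h1 h2
    rw [abs_le]
    constructor <;> linarith
  have hBC2 : Tendsto (fun j => lossBC2 T (fun t x => (M j).eval σ ![t, x])) atTop (𝓝 0) := by
    refine tendsto_zero_of_le_ofReal_mul (ENNReal.mul_ne_top (by simp) (hfin 0 T)) (hpow 1)
      fun j => lossBC2_le fun t ht x hx => ?_
    have h1 := (hM j t (hIoo ht) x (hend hx)).1
    rw [hS.dirichlet t (hIoo ht) x hx, sub_zero] at h1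
    rw [one_mul]
    exact h1.le
  have hvolV : volume.real V = 20 := by
    rw [V, Real.volume_real_Icc]; norm_num
  have hintV : ∀ t ∈ Icc 0 T, ∀ x ∈ Icc (-1 : ℝ) 1, IntegrableOn (f t x) V :=
    fun t ht x hx => (hS.integrable t ht x hx).mono_set hVD
  have hdiff : ∀ t ∈ Icc 0 T, ∀ x ∈ Icc (-1 : ℝ) 1,
      ∫ v in D \ V, f t x v = ρ t x - ∫ v in V, f t x v := fun t ht x hx =>
    setIntegral_sdiff measurableSet_Icc (hS.integrable t ht x hx) hVD
  have hdiffb : ∀ t ∈ Icc 0 T, ∀ x ∈ Icc (-1 : ℝ) 1, |∫ v in D \ V, f t x v| ≤ R + 20 * C := by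
    intro t ht x hx
    have h1 : ‖∫ v in V, f t x v‖ ≤ C * volume.real V :=
      norm_setIntegral_le_of_norm_le_const hfinV.lt_top fun v hv => (hC t ht x hx v hv).1
    rw [hvolV, Real.norm_eq_abs] at h1
    rw [hdiff t ht x hx]
    refine (abs_sub _ _).trans ?_
    linarith [hR' t ht x hx]
  -- The network residual tends to `(ρ - h) - (∫_V f - h)`, the mass outside `V`. The error is `1`
  -- for the derivative of the field and `20`, the length of `V`, for the density.
  have hclose : ∀ j, ∀ t ∈ Ioo 0 T, ∀ x ∈ Ioo (-1 : ℝ) 1,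
      |(deriv (fun y => (M j).eval σ ![t, y]) x - ((∫ v in V, (N j).eval σ ![t, x, v]) - h x))
        - ∫ v in D \ V, f t x v| ≤ 21 * ε j := by
    intro j t ht x hx
    rw [((M j).hasDerivAt_eval_snd hσ t x).deriv, hdiff t (hIoo ht) x (hIoo' hx)]
    have hcont : Continuous fun v => (N j).eval σ ![t, x, v] :=
      ((N j).continuous_eval hσ.continuous).comp (by fun_prop)
    have h1 : ‖∫ v in V, ((N j).eval σ ![t, x, v] - f t x v)‖ ≤ ε j * volume.real V :=
      norm_setIntegral_le_of_norm_le_const hfinV.lt_top fun v hv =>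
        (hN j t (hIoo ht) x (hIoo' hx) v hv).1.le
    have hNV : IntegrableOn (fun v => (N j).eval σ ![t, x, v]) V := hcont.integrableOn_Icc
    rw [integral_sub hNV (hintV t (hIoo ht) x (hIoo' hx)), hvolV,
      Real.norm_eq_abs] at h1
    have h2 := (hM j t (hIoo ht) x (hIoo' hx)).2
    rw [abs_lt] at h2
    rw [abs_le] at h1 ⊢
    constructor <;> linarith
  have hS0 : 0 ≤ R + 20 * C := (abs_nonneg _).trans (hdiffb 0 hmem.1 0 hmem.2.1)
  have hGE2 : Tendsto (fun j => lossGE2 T h (fun t x v => (N j).eval σ ![t, x, v])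
      (fun t x => (M j).eval σ ![t, x])) atTop
      (𝓝 (∫⁻ t in Ioo 0 T, ∫⁻ x in Ioo (-1) 1, ‖∫ v in D \ V, f t x v‖ₑ ^ 2)) := by
    -- The squares are compared in both directions, so the bound must hold for the missing mass and
    -- for the network residual; the latter exceeds `R + 20 * C` by at most `21 * ε j`.
    have hc : Tendsto (fun j => ENNReal.ofReal (21 * ε j * (2 * (R + 20 * C + 21 * ε j) + 21 * ε j))
        * (volume (Ioo (-1 : ℝ) 1) * volume (Ioo 0 T))) atTop (𝓝 0) := by
      refine tendsto_zero_of_le_ofReal_mul (ENNReal.mul_ne_top (hfin (-1) 1) (hfin 0 T)) ?_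
        fun j => le_rfl
      have h21 := hε0.const_mul 21
      have := h21.mul ((((h21.const_add (R + 20 * C))).const_mul 2).add h21)
      simpa using this
    refine tendsto_of_le_add_of_le_add (ne_top_of_le_ne_top ?_ (setLIntegral_le_const
      measurableSet_Ioo fun t ht => setLIntegral_le_const measurableSet_Ioo fun x hx =>
        enorm_sq_le (hdiffb t (hIoo ht) x (hIoo' hx)))) hc
      (fun j => lintegral_lintegral_le_add fun t ht x hx => ?_) (fun j => lintegral_lintegral_le_add fun t ht x hx => ?_)
    · exact ENNReal.mul_ne_top (ENNReal.mul_ne_top ENNReal.ofReal_ne_top (hfin _ _)) (hfin _ _)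
    · refine enorm_sq_le_add ?_ (hclose j t ht x hx)
      linarith [hdiffb t (hIoo ht) x (hIoo' hx), hεpos j]
    · refine enorm_sq_le_add ?_ ((abs_sub_comm _ _).trans_le (hclose j t ht x hx))
      have h1 := hdiffb t (hIoo ht) x (hIoo' hx)
      have h2 := hclose j t ht x hx
      rw [abs_le] at h1 h2 ⊢
      constructor <;> linarith
  have := ((hGE1.add hGE2).add (hIC1.add hIC2)).add (hBC1.add hBC2)
  simpa only [lossTotal, zero_add, add_zero] using this

end Convergence

end VPFP

theorem mainTheorem3 (T : ℝ) (hT : 0 < T)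
    (σ : ℝ → ℝ) (hσ : ContDiff ℝ 2 σ)
    (hσ_nonpoly : ¬ ∃ P : Polynomial ℝ, ∀ s : ℝ, σ s = P.eval s)
    (h : ℝ → ℝ) (hh : ContinuousOn h (Icc (-1) 1))
    (f₀ : ℝ → ℝ → ℝ) (f : ℝ → ℝ → ℝ → ℝ) (E : ℝ → ℝ → ℝ)
    (hf : VPFP.CHat ![1, 1, 2] (VPFP.phaseCylinder T) (fun p => f (p 0) (p 1) (p 2))) :
    (VPFP.IsSolution VPFP.V T h f₀ f E →
      ∃ (N : ℕ → VPFP.ShallowNet 3) (M : ℕ → VPFP.ShallowNet 2),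
        Tendsto (fun j => VPFP.lossTotal VPFP.V T h f₀
            (fun t x v => (N j).eval σ ![t, x, v]) (fun t x => (M j).eval σ ![t, x]))
          atTop (𝓝 0)) ∧
    (VPFP.IsSolution univ T h f₀ f E →
      ∃ (N : ℕ → VPFP.ShallowNet 3) (M : ℕ → VPFP.ShallowNet 2),
        Tendsto (fun j => VPFP.lossTotal univ T h f₀
            (fun t x v => (N j).eval σ ![t, x, v]) (fun t x => (M j).eval σ ![t, x]))
          atTop (𝓝 (VPFP.truncationError T f))) := by
  refine ⟨fun hS => ?_, fun hS => ?_⟩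
  · simpa using VPFP.exists_tendsto_lossTotal (D := VPFP.V) hT hσ hσ_nonpoly hh hf
      measurableSet_Icc Subset.rfl hS
  · simpa only [VPFP.truncationError, ← compl_eq_univ_sdiff] using
      VPFP.exists_tendsto_lossTotal hT hσ hσ_nonpoly hh hf MeasurableSet.univ (subset_univ _) hS
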